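/- Let $n\ge 5$ be a prime number, $q=2^n$, and let $r\ge 3$ be an integer with $\gcd(r,n)=1$. Let $\mathcal{I}_r$ be the set of monic irreducible polynomials of degree $r$ over $\mathbb{F}_q$, on which $\mathrm{PGL}_2(\mathbb{F}_q)$ acts as follows: the class of $A=\begin{pmatrix}a&b\\c&d\end{pmatrix}$ sends $f$ to the monic scalar multiple of $(-cx+a)^r f\!\left(\frac{dx-b}{-cx+a}\right)$. Let $\varphi$ and $\mu$ be Euler's totient function and the Möbius function. Then the number of $\mathrm{PGL}_2(\mathbb{F}_q)$-orbits on $\mathcal{I}_r$ is $$\big|\mathrm{PGL}_2(\mathbb{F}_q)\backslash\mathcal{I}_r\big|=\frac{1}{q(q^2-1)}\big(\mathcal{N}_0+\mathcal{N}_1+\mathcal{N}_2+\mathcal{N}_3\big),$$ where $$\mathcal{N}_0=|\mathcal{I}_r|=\frac1r\sum_{d\mid r}\mu(d)q^{r/d},\qquad \mathcal{N}_1=\begin{cases}0,& 2\nmid r,\\[2pt] \dfrac{q^2-1}{r}\displaystyle\sum_{d\mid \frac r2,\ \gcd(2,d)=1}\mu(d)q^{\frac{r}{2d}},& 2\mid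 r,\end{cases}$$ $$\mathcal{N}_2=\frac{q(q+1)}{2}\sum_{D\mid\gcd(r,q-1),\ D\ne1}\frac{\varphi(D)^2}{r}\sum_{d\mid\frac rD,\ \gcd(d,D)=1}\mu(d)\big(q^{\frac{r}{Dd}}-1\big),$$ $$\mathcal{N}_3=\frac{q(q-1)}{2}\sum_{D\mid\gcd(r,q+1),\ D\ne1}\frac{\varphi(D)^2}{r}\sum_{d\mid\frac rD,\ \gcd(d,D)=1}\mu(d)\Big(q^{\frac{r}{Dd}}+(-1)^{\frac{r}{Dd}+1}\Big).$$ -/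

import Mathlib

open Polynomial
open scoped MatrixGroups

noncomputable section

namespace GoppaOrbits

variable {F : Type*} [Field F]

/-- For `A = !![a, b; c, d]` and a polynomial `f` of degree at most `k`, this is
`(-c x + a) ^ k * f ((d x - b) / (-c x + a))`. -/
def mobiusSubst (k : ℕ) (A : Matrix (Fin 2) (Fin 2) F) (f : F[X]) : F[X] :=
  ∑ i ∈ Finset.range (k + 1),
    C (f.coeff i) * (C (A 1 1) * X - C (A 0 1)) ^ i * (C (A 0 0) - C (A 1 0) * X) ^ (k - i)

lemma natDegree_mobiusSubst_le (k : ℕ) (A : Matrix (Fin 2) (Fin 2) F) (f : F[X]) :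
    (mobiusSubst k A f).natDegree ≤ k := by
  refine natDegree_sum_le_of_forall_le _ _ fun i hi => ?_
  have hi' : i ≤ k := by simpa [Nat.lt_succ_iff] using hi
  have h1 : (C (A 1 1) * X - C (A 0 1)).natDegree ≤ 1 := by compute_degree
  have h2 : (C (A 0 0) - C (A 1 0) * X).natDegree ≤ 1 := by compute_degree
  calc _ ≤ 0 + i * 1 + (k - i) * 1 := by
        refine natDegree_mul_le_of_le (natDegree_mul_le_of_le ?_ ?_) ?_
        · simp
        · exact natDegree_pow_le_of_le i h1
        · exact natDegree_pow_le_of_le (k - i) h2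
    _ = k := by omega

lemma mobiusSubst_C_mul (k : ℕ) (A : Matrix (Fin 2) (Fin 2) F) (c : F) (f : F[X]) :
    mobiusSubst k A (C c * f) = C c * mobiusSubst k A f := by
  simp only [mobiusSubst, Finset.mul_sum, coeff_C_mul, C_mul, mul_assoc]

lemma mobiusSubst_scalar {k : ℕ} (u : F) {f : F[X]} (hf : f.natDegree ≤ k) :
    mobiusSubst k (Matrix.scalar (Fin 2) u) f = C (u ^ k) * f := by
  conv_rhs => rw [f.as_sum_range_C_mul_X_pow' (Nat.lt_succ_of_le hf)]
  rw [mobiusSubst, Finset.mul_sum]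
  refine Finset.sum_congr rfl fun i hi => ?_
  have hi' : i ≤ k := by simpa [Nat.lt_succ_iff] using hi
  have : u ^ k = u ^ i * u ^ (k - i) := by rw [← pow_add]; congr 1; omega
  simp only [this, Matrix.scalar_apply, Matrix.diagonal_apply]
  simp [mul_pow]
  ring

lemma mobiusSubst_one {k : ℕ} {f : F[X]} (hf : f.natDegree ≤ k) :
    mobiusSubst k 1 f = f := by
  simpa using mobiusSubst_scalar (1 : F) hf

lemma mobiusSubst_const_one (k : ℕ) (A : Matrix (Fin 2) (Fin 2) F) :
    mobiusSubst k A 1 = (C (A 0 0) - C (A 1 0) * X) ^ k := by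
  rw [mobiusSubst, Finset.sum_eq_single 0]
  · simp
  · intro i _ hi
    simp [coeff_one, hi]
  · simp

lemma den_ne_zero {A : Matrix (Fin 2) (Fin 2) F} (hA : A.det ≠ 0) :
    (C (A 0 0) - C (A 1 0) * X : F[X]) ≠ 0 := by
  intro h
  have h0 := congrArg (fun p => coeff p 0) h
  have h1 := congrArg (fun p => coeff p 1) h
  simp [coeff_C] at h0 h1
  apply hA
  rw [Matrix.det_fin_two, h0, h1]
  ring

lemma algebraMap_mobiusSubst {k : ℕ} {A : Matrix (Fin 2) (Fin 2) F} (hA : A.det ≠ 0)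
    {f : F[X]} (hf : f.natDegree ≤ k) :
    algebraMap F[X] (FractionRing F[X]) (mobiusSubst k A f) =
      algebraMap F[X] (FractionRing F[X]) (C (A 0 0) - C (A 1 0) * X) ^ k *
        aeval (algebraMap F[X] (FractionRing F[X]) (C (A 1 1) * X - C (A 0 1)) /
          algebraMap F[X] (FractionRing F[X]) (C (A 0 0) - C (A 1 0) * X)) f := by
  have hq : algebraMap F[X] (FractionRing F[X]) (C (A 0 0) - C (A 1 0) * X) ≠ 0 := by
    rw [Ne, FaithfulSMul.algebraMap_eq_zero_iff]
    exact den_ne_zero hA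
  rw [mobiusSubst, map_sum, aeval_eq_sum_range' (Nat.lt_succ_of_le hf), Finset.mul_sum]
  refine Finset.sum_congr rfl fun i hi => ?_
  have hi' : i ≤ k := by simpa [Nat.lt_succ_iff] using hi
  rw [map_mul, map_mul, map_pow, map_pow, Algebra.smul_def,
    IsScalarTower.algebraMap_apply F F[X] (FractionRing F[X]), Polynomial.algebraMap_eq]
  generalize algebraMap F[X] (FractionRing F[X]) (C (A 0 0) - C (A 1 0) * X) = q at *
  have : q ^ k = q ^ i * q ^ (k - i) := by rw [← pow_add]; congr 1; omega
  rw [this, div_pow]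
  have hqi := pow_ne_zero i hq
  field_simp

lemma mobiusSubst_mul {k l : ℕ} {A : Matrix (Fin 2) (Fin 2) F} (hA : A.det ≠ 0)
    {g h : F[X]} (hg : g.natDegree ≤ k) (hh : h.natDegree ≤ l) :
    mobiusSubst (k + l) A (g * h) = mobiusSubst k A g * mobiusSubst l A h := by
  apply FaithfulSMul.algebraMap_injective F[X] (FractionRing F[X])
  rw [map_mul, algebraMap_mobiusSubst hA hg, algebraMap_mobiusSubst hA hh,
    algebraMap_mobiusSubst hA (natDegree_mul_le_of_le hg hh), map_mul, pow_add]
  ring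

lemma mobiusSubst_mobiusSubst {k : ℕ} {A : Matrix (Fin 2) (Fin 2) F} (hA : A.det ≠ 0)
    (B : Matrix (Fin 2) (Fin 2) F) (f : F[X]) :
    mobiusSubst k A (mobiusSubst k B f) = mobiusSubst k (A * B) f := by
  apply FaithfulSMul.algebraMap_injective F[X] (FractionRing F[X])
  have hq : algebraMap F[X] (FractionRing F[X]) (C (A 0 0) - C (A 1 0) * X) ≠ 0 := by
    rw [Ne, FaithfulSMul.algebraMap_eq_zero_iff]
    exact den_ne_zero hA
  rw [algebraMap_mobiusSubst hA (natDegree_mobiusSubst_le k B f), mobiusSubst, mobiusSubst,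
    map_sum, map_sum, Finset.mul_sum]
  refine Finset.sum_congr rfl fun i hi => ?_
  have hi' : i ≤ k := by simpa [Nat.lt_succ_iff] using hi
  simp only [map_mul, map_pow, map_sub, aeval_C, aeval_X, Matrix.mul_apply, Fin.sum_univ_two,
    map_add, IsScalarTower.algebraMap_apply F F[X] (FractionRing F[X]),
    Polynomial.algebraMap_eq] at hq ⊢
  generalize algebraMap F[X] (FractionRing F[X]) (C (A 0 0)) = a at *
  generalize algebraMap F[X] (FractionRing F[X]) (C (A 0 1)) = b at *
  generalize algebraMap F[X] (FractionRing F[X]) (C (A 1 0)) = c at *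
  generalize algebraMap F[X] (FractionRing F[X]) (C (A 1 1)) = d at *
  generalize algebraMap F[X] (FractionRing F[X]) (C (B 0 0)) = a' at *
  generalize algebraMap F[X] (FractionRing F[X]) (C (B 0 1)) = b' at *
  generalize algebraMap F[X] (FractionRing F[X]) (C (B 1 0)) = c' at *
  generalize algebraMap F[X] (FractionRing F[X]) (C (B 1 1)) = d' at *
  generalize algebraMap F[X] (FractionRing F[X]) X = x at *
  generalize algebraMap F[X] (FractionRing F[X]) (C (f.coeff i)) = e at *
  have h1 : (c * b' + d * d') * x - (a * b' + b * d') =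
      (a - c * x) * (d' * ((d * x - b) / (a - c * x)) - b') := by
    field_simp
    ring
  have h2 : (a * a' + b * c') - (c * a' + d * c') * x =
      (a - c * x) * (a' - c' * ((d * x - b) / (a - c * x))) := by
    field_simp
    ring
  have h3 : (a - c * x) ^ k = (a - c * x) ^ i * (a - c * x) ^ (k - i) := by
    rw [← pow_add]; congr 1; omega
  rw [h1, h2, h3, mul_pow, mul_pow]
  ring

lemma mobiusSubst_inv {k : ℕ} (A : GL (Fin 2) F) {f : F[X]} (hf : f.natDegree ≤ k) :
    mobiusSubst k (A⁻¹ : GL (Fin 2) F).1 (mobiusSubst k A.1 f) = f := by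
  rw [mobiusSubst_mobiusSubst (A⁻¹).det.ne_zero, ← Units.val_mul, inv_mul_cancel, Units.val_one,
    mobiusSubst_one hf]

lemma natDegree_mobiusSubst {r : ℕ} (hr : 2 ≤ r) (A : GL (Fin 2) F) {f : F[X]}
    (hf : Irreducible f) (hd : f.natDegree = r) : (mobiusSubst r A.1 f).natDegree = r := by
  refine le_antisymm (natDegree_mobiusSubst_le _ _ _) ?_
  by_contra! hlt
  set e := (mobiusSubst r A.1 f).natDegree with he
  have hB := (A⁻¹).det.ne_zero
  have key := mobiusSubst_mul hB he.symm.le (show (1 : F[X]).natDegree ≤ r - e by simp)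
  rw [mul_one, show e + (r - e) = r by omega, mobiusSubst_inv A hd.le,
    mobiusSubst_const_one] at key
  set v : F[X] := C ((A⁻¹ : GL (Fin 2) F).1 0 0) - C ((A⁻¹ : GL (Fin 2) F).1 1 0) * X with hv
  have hv1 : v.natDegree ≤ 1 := by rw [hv]; compute_degree
  have hdvd : v ∣ f := by
    rw [key]
    exact Dvd.dvd.mul_left (dvd_pow_self _ (by omega)) _
  rcases (hf.dvd_iff.mp hdvd) with hu | hu
  · have h0 : (v ^ (r - e)).natDegree = 0 := natDegree_eq_zero_of_isUnit (hu.pow _)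
    have : f.natDegree ≤ e := by
      rw [key]
      calc _ ≤ e + 0 := natDegree_mul_le_of_le (natDegree_mobiusSubst_le _ _ _) h0.le
        _ = e := rfl
    omega
  · have := natDegree_eq_of_degree_eq (degree_eq_degree_of_associated hu)
    omega

lemma irreducible_mobiusSubst {r : ℕ} (hr : 2 ≤ r) (A : GL (Fin 2) F) {f : F[X]}
    (hf : Irreducible f) (hd : f.natDegree = r) : Irreducible (mobiusSubst r A.1 f) := by
  have hdeg := natDegree_mobiusSubst hr A hf hd
  have hne : mobiusSubst r A.1 f ≠ 0 := by
    intro h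
    rw [h, natDegree_zero] at hdeg
    omega
  have hB := (A⁻¹).det.ne_zero
  refine ⟨fun hu => ?_, fun g h hgh => ?_⟩
  · have := natDegree_eq_zero_of_isUnit hu
    omega
  · have hg0 : g ≠ 0 := by rintro rfl; simp [hgh] at hne
    have hh0 : h ≠ 0 := by rintro rfl; simp [hgh] at hne
    have hsum : g.natDegree + h.natDegree = r := by
      rw [← natDegree_mul hg0 hh0, ← hgh, hdeg]
    have key := mobiusSubst_mul hB (le_refl g.natDegree) (le_refl h.natDegree)
    rw [hsum, ← hgh, mobiusSubst_inv A hd.le] at key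
    have d1 := natDegree_mobiusSubst_le g.natDegree (A⁻¹ : GL (Fin 2) F).1 g
    have d2 := natDegree_mobiusSubst_le h.natDegree (A⁻¹ : GL (Fin 2) F).1 h
    have d3 := congrArg natDegree key
    rw [natDegree_mul (by rintro h0; rw [h0] at key; exact hf.ne_zero (by rw [key]; ring))
      (by rintro h0; rw [h0] at key; exact hf.ne_zero (by rw [key]; ring)), hd] at d3
    rcases hf.isUnit_or_isUnit key with hu | hu
    · left
      have := natDegree_eq_zero_of_isUnit hu
      exact (isUnit_iff_degree_eq_zero).2 (by rw [degree_eq_natDegree hg0]; norm_cast; omega)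
    · right
      have := natDegree_eq_zero_of_isUnit hu
      exact (isUnit_iff_degree_eq_zero).2 (by rw [degree_eq_natDegree hh0]; norm_cast; omega)

/-- The set of monic irreducible polynomials of degree `r` over `F`. -/
def MonicIrred (F : Type*) [Field F] (r : ℕ) : Type _ :=
  {f : F[X] // f.Monic ∧ Irreducible f ∧ f.natDegree = r}

/-- `f ^* = (1 / a_r) f`, where `a_r` is the leading coefficient of `f`. -/
def makeMonic (f : F[X]) : F[X] := C f.leadingCoeff⁻¹ * f

lemma makeMonic_C_mul {c : F} (hc : c ≠ 0) (f : F[X]) : makeMonic (C c * f) = makeMonic f := by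
  rw [makeMonic, makeMonic, leadingCoeff_mul, leadingCoeff_C, ← mul_assoc, ← C_mul, mul_inv]
  congr 2
  field_simp

lemma makeMonic_of_monic {f : F[X]} (hf : f.Monic) : makeMonic f = f := by
  simp [makeMonic, hf.leadingCoeff]

/-- The action of `GL₂` on monic irreducible polynomials of degree `r`:
`f ↦ ((-c x + a) ^ r * f ((d x - b) / (-c x + a))) ^*`. -/
abbrev glAction (F : Type*) [Field F] (r : ℕ) (hr : 2 ≤ r) :
    MulAction (GL (Fin 2) F) (MonicIrred F r) where
  smul A f := ⟨makeMonic (mobiusSubst r A.1 f.1), by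
    have hi := irreducible_mobiusSubst hr A f.2.2.1 f.2.2.2
    have hl : (mobiusSubst r A.1 f.1).leadingCoeff⁻¹ ≠ 0 :=
      inv_ne_zero (leadingCoeff_ne_zero.2 hi.ne_zero)
    refine ⟨?_, ?_, ?_⟩
    · rw [Monic, makeMonic, leadingCoeff_mul, leadingCoeff_C]
      exact inv_mul_cancel₀ (leadingCoeff_ne_zero.2 hi.ne_zero)
    · exact (irreducible_isUnit_mul (isUnit_C.2 hl.isUnit)).2 hi
    · rw [makeMonic, natDegree_C_mul hl]
      exact natDegree_mobiusSubst hr A f.2.2.1 f.2.2.2⟩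
  one_smul f := Subtype.ext <| by
    change makeMonic (mobiusSubst r 1 f.1) = f.1
    rw [mobiusSubst_one f.2.2.2.le, makeMonic_of_monic f.2.1]
  mul_smul A B f := Subtype.ext <| by
    change makeMonic (mobiusSubst r (A * B : GL (Fin 2) F).1 f.1) =
      makeMonic (mobiusSubst r A.1 (makeMonic (mobiusSubst r B.1 f.1)))
    have hi := irreducible_mobiusSubst hr B f.2.2.1 f.2.2.2
    have hl : (mobiusSubst r B.1 f.1).leadingCoeff⁻¹ ≠ 0 :=
      inv_ne_zero (leadingCoeff_ne_zero.2 hi.ne_zero)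
    rw [makeMonic.eq_1 (mobiusSubst r B.1 f.1), mobiusSubst_C_mul, makeMonic_C_mul hl,
      mobiusSubst_mobiusSubst A.det.ne_zero, Units.val_mul]

/-- The induced action of `PGL₂(F)` on monic irreducible polynomials of degree `r`. -/
abbrev pglAction (F : Type*) [Field F] (r : ℕ) (hr : 2 ≤ r) :
    MulAction PGL(2, F) (MonicIrred F r) :=
  letI := glAction F r hr
  Matrix.ProjGenLinGroup.mulActionOfGL fun u f => Subtype.ext <| by
    change makeMonic (mobiusSubst r (Matrix.scalar (Fin 2) (u : F)) f.1) = f.1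
    rw [mobiusSubst_scalar (u : F) f.2.2.2.le, makeMonic_C_mul (pow_ne_zero _ u.ne_zero),
      makeMonic_of_monic f.2.1]

/-- The set of `PGL₂(F)`-orbits on monic irreducible polynomials of degree `r`. -/
def PGLOrbits (F : Type*) [Field F] (r : ℕ) (hr : 2 ≤ r) : Type _ :=
  letI := pglAction F r hr
  MulAction.orbitRel.Quotient PGL(2, F) (MonicIrred F r)

open ArithmeticFunction in
/-- `N₀ = (1/r) ∑_{d ∣ r} μ(d) q^{r/d}`. -/
def N0 (q r : ℕ) : ℚ :=
  1 / (r : ℚ) * ∑ d ∈ r.divisors, (moebius d : ℚ) * (q : ℚ) ^ (r / d)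

open ArithmeticFunction in
/-- `N₁ = 0` for odd `r`, and
`N₁ = ((q² - 1)/r) ∑_{d ∣ r/2, gcd(2,d) = 1} μ(d) q^{r/(2d)}` for even `r`. -/
def N1 (q r : ℕ) : ℚ :=
  if 2 ∣ r then
    ((q : ℚ) ^ 2 - 1) / (r : ℚ) *
      ∑ d ∈ (r / 2).divisors with Nat.gcd 2 d = 1, (moebius d : ℚ) * (q : ℚ) ^ (r / (2 * d))
  else 0

open ArithmeticFunction in
/-- `N₂ = (q(q+1)/2) ∑_{D ∣ gcd(r,q-1), D ≠ 1} (φ(D)²/r)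
∑_{d ∣ r/D, gcd(d,D) = 1} μ(d) (q^{r/(Dd)} - 1)`. -/
def N2 (q r : ℕ) : ℚ :=
  (q : ℚ) * ((q : ℚ) + 1) / 2 *
    ∑ D ∈ (Nat.gcd r (q - 1)).divisors with D ≠ 1,
      (Nat.totient D : ℚ) ^ 2 / (r : ℚ) *
        ∑ d ∈ (r / D).divisors with Nat.gcd d D = 1,
          (moebius d : ℚ) * ((q : ℚ) ^ (r / (D * d)) - 1)

open ArithmeticFunction in
/-- `N₃ = (q(q-1)/2) ∑_{D ∣ gcd(r,q+1), D ≠ 1} (φ(D)²/r)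
∑_{d ∣ r/D, gcd(d,D) = 1} μ(d) (q^{r/(Dd)} + (-1)^{r/(Dd)+1})`. -/
def N3 (q r : ℕ) : ℚ :=
  (q : ℚ) * ((q : ℚ) - 1) / 2 *
    ∑ D ∈ (Nat.gcd r (q + 1)).divisors with D ≠ 1,
      (Nat.totient D : ℚ) ^ 2 / (r : ℚ) *
        ∑ d ∈ (r / D).divisors with Nat.gcd d D = 1,
          (moebius d : ℚ) * ((q : ℚ) ^ (r / (D * d)) + (-1) ^ (r / (D * d) + 1))

end GoppaOrbits

end

noncomputable section

namespace GoppaOrbits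

open Function ArithmeticFunction

/-! Burnside's lemma is applied to `GL₂(F)`. Scalars act trivially, so the orbits are those of
`PGL₂(F)`, at the price of a factor `q - 1`. Let `K` be the algebraic closure of `F` and `σ` the
`q`-power Frobenius on the projective line over `K`. The roots of a monic irreducible polynomial of
degree `r` form one `σ`-orbit of length `r`, and the action moves roots by Möbius maps. Hence `r`
times the number of polynomials fixed by `A` is the number of points `x` of `σ`-period `r` with `A x
= σ^i x` for some `i < r` (`mul_ncard_fixed`).

Let `A` be nonscalar. It commutes with `σ`, its fixed points have degree at most `2 < r`, and every
other point has an `A`-orbit of the same length `D`. Comparing orders, `A x = σ^i x` forces `gcd(r,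
i) = r / D`, so `D ∣ r` and `φ(D)` values of `i` remain. For each of them a Möbius sieve over the
`d` prime to `D` isolates exact period `r` (`ncard_minimalPeriod_eq`). The sieve needs the number of
nonfixed solutions of `A^e x = σ^w x` for `e` prime to `D`. That equation has `q^w + 1` solutions in
all (`ncard_projAct_eq_frob`), and the fixed points of `A` among them are those defined over the
extension of degree `w`. There are 2 of these for distinct eigenvalues in `F`, 1 for a repeated
eigenvalue, and `1 + (-1)^w` for conjugate eigenvalues outside `F`.

It remains to sum over matrices. Here `D` is the order of the ratio of the eigenvalues if these are
distinct, and 2 if they coincide, the characteristic being 2. Each order `D` is attained by `φ(D)`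
ratios, which gives the second totient. Each ratio allows `q - 1` eigenvalue pairs, each pair
belongs to `q(q + 1)` or `q(q - 1)` matrices, and every matrix is met twice because its eigenvalues
can be ordered in two ways. Scalars give `N0`, the other repeated eigenvalues `N1`, the split
matrices `N2`, the nonsplit ones `N3`. -/

lemma exists_coprime_mul_modEq_one {j D : ℕ} (hj : j.Coprime D) (hD : 0 < D) :
    ∃ e, Nat.Coprime e D ∧ j * e ≡ 1 [MOD D] := by
  obtain ⟨e, he⟩ : ∃ e, j * e ≡ 1 [MOD D] := by
    rcases Nat.lt_or_ge 1 D with h | h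
    · obtain ⟨e, _, he⟩ := Nat.exists_mul_mod_eq_one_of_coprime hj h
      exact ⟨e, by rw [Nat.ModEq, he, Nat.mod_eq_of_lt h]⟩
    · obtain rfl : D = 1 := by omega
      exact ⟨1, Nat.modEq_one⟩
  have : Nat.Coprime (j * e) D := by
    rw [Nat.coprime_iff_gcd_eq_one, he.gcd_eq, Nat.gcd_one_left]
  exact ⟨e, Nat.Coprime.coprime_mul_left this, he⟩

/-! ### Two commuting maps: sieving by the period -/

section Periods

variable {X : Type*} {σ A : X → X} {Y : Set X} {D : ℕ}

lemma iterate_eq_of_apply_eq (hc : Function.Commute A σ) {x : X} {m : ℕ} (h : A x = σ^[m] x)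
    (k : ℕ) : A^[k] x = σ^[m * k] x := by
  induction k with
  | zero => simp
  | succ k ih =>
    rw [iterate_succ_apply', ih, (hc.iterate_right (m * k)).eq, h, ← iterate_add_apply]
    congr 1

lemma iterate_eq_iterate_of_modEq {f : X → X} {x : X} {n a b : ℕ} (h : f^[n] x = x)
    (hab : a ≡ b [MOD n]) : f^[a] x = f^[b] x := by
  have hp : IsPeriodicPt f n x := h
  rw [← hp.iterate_mod_apply a, ← hp.iterate_mod_apply b, hab]

/-- If `A` acts on `x` as an element of exact order `D`, and as `σ ^ m`, then the `σ`-period of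
`x` is `g * D` for a divisor `g` of `m` with `m / g` prime to `D`. -/
lemma exists_minimalPeriod_eq (hc : Function.Commute A σ) {m : ℕ} (hm : 0 < m)
    {x : X} (hA : ∀ k, A^[k] x = x ↔ D ∣ k) (h : A x = σ^[m] x) :
    ∃ g, g ∣ m ∧ Nat.Coprime (m / g) D ∧ minimalPeriod σ x = g * D := by
  set p := minimalPeriod σ x with hp
  -- Since `A^k x = σ^(m k) x`, the `A`-period of `x` is `p / gcd(p, m)`. It is also `D`.
  have key : ∀ k, p ∣ m * k ↔ D ∣ k := fun k => by
    rw [← hA, iterate_eq_of_apply_eq hc h]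
    exact isPeriodicPt_iff_minimalPeriod_dvd.symm
  have hg : 0 < p.gcd m := Nat.gcd_pos_of_pos_right _ hm
  obtain ⟨a, ha⟩ := Nat.gcd_dvd_left p m
  obtain ⟨b, hb⟩ := Nat.gcd_dvd_right p m
  set g := p.gcd m with hgdef
  have hab : Nat.Coprime a b := by
    have := Nat.coprime_div_gcd_div_gcd (m := p) (n := m) hg
    rwa [← hgdef, Nat.div_eq_of_eq_mul_right hg ha, Nat.div_eq_of_eq_mul_right hg hb] at this
  have key' : ∀ k, a ∣ k ↔ D ∣ k := fun k => by
    rw [← key, ha, hb, mul_assoc, Nat.mul_dvd_mul_iff_left hg, hab.dvd_mul_left]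
  have haD : a = D := Nat.dvd_antisymm ((key' D).2 dvd_rfl) ((key' a).1 dvd_rfl)
  refine ⟨g, ⟨b, hb⟩, ?_, by rw [← haD]; exact ha⟩
  rw [Nat.div_eq_of_eq_mul_right hg hb, ← haD]
  exact hab.symm

/-- Sieving the solutions of `A y = σ ^ m y` by their `σ`-period. -/
lemma ncard_minimalPeriod_eq (hc : Function.Commute A σ) (hD : 0 < D)
    (hA : ∀ y ∈ Y, ∀ k, A^[k] y = y ↔ D ∣ k) {T : ℕ → ℤ}
    (hfin : ∀ e w, 0 < w → e.Coprime D → {y | y ∈ Y ∧ A^[e] y = σ^[w] y}.Finite)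
    (hT : ∀ e w, 0 < w → e.Coprime D → ({y | y ∈ Y ∧ A^[e] y = σ^[w] y}.ncard : ℤ) = T w)
    {m : ℕ} (hm : 0 < m) :
    ({y | y ∈ Y ∧ A y = σ^[m] y ∧ minimalPeriod σ y = m * D}.ncard : ℤ) =
      ∑ d ∈ m.divisors with Nat.gcd d D = 1, moebius d * T (m / d) := by
  classical
  have hf1 : {y | y ∈ Y ∧ A y = σ^[m] y}.Finite := by
    simpa using hfin 1 m hm (Nat.coprime_one_left D)
  set S := hf1.toFinset with hS
  have hmem : ∀ y, y ∈ S ↔ y ∈ Y ∧ A y = σ^[m] y := fun y => by simp [hS]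
  -- If `y` has period `g D` and `m = g b` with `b` prime to `D`, the surviving `d` are exactly the
  -- divisors of `b`. So the sum is `∑_{d ∣ b} μ(d)`, which is 1 for `b = 1` and 0 otherwise.
  have hind : ∀ y ∈ S, (if minimalPeriod σ y = m * D then (1 : ℤ) else 0) =
      ∑ d ∈ m.divisors with Nat.gcd d D = 1,
        if minimalPeriod σ y ∣ m / d * D then moebius d else 0 := by
    intro y hy
    obtain ⟨hyY, hy⟩ := (hmem y).1 hy
    obtain ⟨g, ⟨b, rfl⟩, hco, hp⟩ := exists_minimalPeriod_eq hc hm (hA y hyY) hy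
    have hg : 0 < g := Nat.pos_of_mul_pos_right hm
    have hb : 0 < b := Nat.pos_of_mul_pos_left hm
    rw [Nat.mul_div_cancel_left _ hg] at hco
    rw [← Finset.sum_filter, hp]
    have : {d ∈ {d ∈ (g * b).divisors | Nat.gcd d D = 1} | g * D ∣ g * b / d * D} =
        b.divisors := by
      ext d
      simp only [Finset.mem_filter, Nat.mem_divisors]
      constructor
      · rintro ⟨⟨⟨⟨c, hc⟩, _⟩, _⟩, h2⟩
        refine ⟨?_, hb.ne'⟩
        rcases Nat.eq_zero_or_pos d with rfl | hd
        · omega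
        rw [hc, Nat.mul_div_cancel_left _ hd, Nat.mul_dvd_mul_iff_right hD] at h2
        obtain ⟨e, rfl⟩ := h2
        refine ⟨e, Nat.eq_of_mul_eq_mul_left hg ?_⟩
        rw [hc]; ring
      · rintro ⟨⟨c, rfl⟩, _⟩
        refine ⟨⟨⟨⟨g * c, by ring⟩, by positivity⟩,
          Nat.Coprime.coprime_dvd_left (Dvd.intro _ rfl) hco⟩, ?_⟩
        have hd : 0 < d := Nat.pos_of_mul_pos_right hb
        rw [show g * (d * c) = d * (g * c) by ring, Nat.mul_div_cancel_left _ hd]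
        exact Nat.mul_dvd_mul_right (Dvd.intro _ rfl) D
    rw [this]
    have hmob := congrArg (fun f : ArithmeticFunction ℤ => f b) moebius_mul_coe_zeta
    simp only [one_apply, ArithmeticFunction.coe_mul_zeta_apply] at hmob
    rw [hmob]
    congr 1
    simp only [eq_iff_iff]
    constructor
    · intro h
      have := Nat.eq_of_mul_eq_mul_right hD h
      exact (Nat.eq_of_mul_eq_mul_left hg (by omega : g * b = g * 1))
    · rintro rfl; ring
  have hlhs : ({y | y ∈ Y ∧ A y = σ^[m] y ∧ minimalPeriod σ y = m * D}.ncard : ℤ) =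
      ∑ y ∈ S, if minimalPeriod σ y = m * D then (1 : ℤ) else 0 := by
    rw [← Finset.sum_filter, Finset.sum_const, nsmul_eq_mul, mul_one, ← Set.ncard_coe_finset]
    congr 2
    ext y
    simp [hmem, and_assoc]
  rw [hlhs, Finset.sum_congr rfl hind, Finset.sum_comm]
  refine Finset.sum_congr rfl fun d hd => ?_
  simp only [Finset.mem_filter, Nat.mem_divisors] at hd
  obtain ⟨⟨⟨w, rfl⟩, _⟩, hdD⟩ := hd
  have hd : 0 < d := Nat.pos_of_mul_pos_right hm
  have hw : 0 < w := Nat.pos_of_mul_pos_left hm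
  rw [Nat.mul_div_cancel_left _ hd]
  -- With `e` inverse to `d` modulo `D`, the conditions `A y = σ^(d w) y` and `σ^(w D) y = y`
  -- together amount to the single equation `A^e y = σ^w y`. This is why the count `T` is required
  -- for all powers of `A` prime to `D`.
  obtain ⟨e, heD, he⟩ := exists_coprime_mul_modEq_one (Nat.coprime_iff_gcd_eq_one.2 hdD) hD
  rw [← hT e w hw heD, ← Finset.sum_filter, Finset.sum_const, nsmul_eq_mul, mul_comm,
    ← Set.ncard_coe_finset]
  congr 3
  ext y
  simp only [Finset.coe_filter, hmem, Set.mem_ofPred_eq, and_assoc]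
  refine and_congr_right fun hy => ?_
  have hAD : A^[D] y = y := (hA y hy D).2 dvd_rfl
  rw [← isPeriodicPt_iff_minimalPeriod_dvd]
  constructor
  · rintro ⟨h1, h2⟩
    rw [iterate_eq_of_apply_eq hc h1, mul_right_comm, mul_comm (d * e)]
    exact iterate_eq_iterate_of_modEq h2 (by simpa using he.mul_left' w)
  · intro h
    have hce : Function.Commute A^[e] σ := hc.iterate_left e
    have h1 := iterate_eq_of_apply_eq hce h d
    have h2 := iterate_eq_of_apply_eq hce h D
    rw [← iterate_mul] at h1 h2
    refine ⟨?_, ?_⟩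
    · rw [mul_comm d w, ← h1, mul_comm e d, iterate_eq_iterate_of_modEq hAD he]
      rfl
    · change σ^[w * D] y = y
      rw [← h2, (hA y hy _)]
      exact Dvd.intro_left e rfl

/-- The number of `y ∈ Y` of `σ`-period `r` that `A` maps into their own `σ`-orbit. -/
lemma ncard_minimalPeriod_eq_and_exists (hc : Function.Commute A σ) (hD : 0 < D)
    (hA : ∀ y ∈ Y, ∀ k, A^[k] y = y ↔ D ∣ k) {T : ℕ → ℤ}
    (hfin : ∀ e w, 0 < w → e.Coprime D → {y | y ∈ Y ∧ A^[e] y = σ^[w] y}.Finite)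
    (hT : ∀ e w, 0 < w → e.Coprime D → ({y | y ∈ Y ∧ A^[e] y = σ^[w] y}.ncard : ℤ) = T w)
    {r : ℕ} (hr : 0 < r) :
    ({y | y ∈ Y ∧ minimalPeriod σ y = r ∧ ∃ i < r, A y = σ^[i] y}.ncard : ℤ) =
      if D ∣ r then Nat.totient D *
        ∑ d ∈ (r / D).divisors with Nat.gcd d D = 1, moebius d * T (r / (D * d)) else 0 := by
  -- Both sides are the `A`-period of `y`.
  have hdiv : ∀ y ∈ Y, minimalPeriod σ y = r → ∀ i, A y = σ^[i] y → r / r.gcd i = D := by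
    intro y hy hp i h
    have key : ∀ k, r / r.gcd i ∣ k ↔ D ∣ k := fun k => by
      rw [← hA y hy, iterate_eq_of_apply_eq hc h]
      change _ ↔ IsPeriodicPt σ (i * k) y
      rw [isPeriodicPt_iff_minimalPeriod_dvd, hp]
      have hg : 0 < r.gcd i := Nat.gcd_pos_of_pos_left _ hr
      have hco := Nat.coprime_div_gcd_div_gcd (m := r) (n := i) hg
      rw [← hco.dvd_mul_left, ← Nat.mul_dvd_mul_iff_left hg, ← mul_assoc,
        Nat.mul_div_cancel' (Nat.gcd_dvd_left r i), Nat.mul_div_cancel' (Nat.gcd_dvd_right r i)]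
    exact Nat.dvd_antisymm ((key D).2 dvd_rfl) ((key _).1 dvd_rfl)
  split_ifs with hDr
  · obtain ⟨m, rfl⟩ := hDr
    have hm : 0 < m := Nat.pos_of_mul_pos_left hr
    rw [Nat.mul_div_cancel_left _ hD]
    -- The admissible exponents, `φ(D)` in number. The exponent `0` is among them exactly when `D =
    -- 1`.
    set I := {i ∈ Finset.range (D * m) | (D * m).gcd i = m} with hI
    have hcardI : I.card = Nat.totient D := by
      rw [hI, ← Nat.totient_div_of_dvd (Dvd.intro_left D rfl), Nat.mul_div_cancel _ hm]
    -- Write `i = m j` with `j` prime to `D`. Replacing `A` by `A^e`, with `e` inverse to `j` modulo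
    -- `D`, turns the exponent `i` into `m`, so all `i` give the same count.
    have hper : ∀ i ∈ I, ∃ e, e.Coprime D ∧ {y | y ∈ Y ∧ A y = σ^[i] y ∧
        minimalPeriod σ y = m * D} =
        {y | y ∈ Y ∧ A^[e] y = σ^[m] y ∧ minimalPeriod σ y = m * D} := by
      intro i hi
      simp only [hI, Finset.mem_filter, Finset.mem_range] at hi
      obtain ⟨j, rfl⟩ : m ∣ i := by
        have := Nat.gcd_dvd_right (D * m) i
        rwa [hi.2] at this
      have hj : j.Coprime D := by
        have := hi.2
        rw [mul_comm D m, Nat.gcd_mul_left] at this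
        have h1 : D.gcd j = 1 := Nat.eq_of_mul_eq_mul_left hm (by omega)
        exact Nat.Coprime.symm h1
      obtain ⟨e, heD, he⟩ := exists_coprime_mul_modEq_one hj hD
      refine ⟨e, heD, ?_⟩
      ext y
      simp only [Set.mem_ofPred_eq]
      refine and_congr_right fun hy => and_congr_left fun hp => ?_
      have hAD : A^[D] y = y := (hA y hy D).2 dvd_rfl
      have hσ : σ^[m * D] y = y := by rw [← hp]; exact isPeriodicPt_minimalPeriod σ y
      constructor
      · intro h
        rw [iterate_eq_of_apply_eq hc h, mul_assoc]
        exact iterate_eq_iterate_of_modEq hσ (by simpa using he.mul_left' m)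
      · intro h
        rw [← iterate_eq_of_apply_eq (hc.iterate_left e) h j, ← iterate_mul, mul_comm e j,
          iterate_eq_iterate_of_modEq hAD he]
        rfl
    have hset : {y | y ∈ Y ∧ minimalPeriod σ y = D * m ∧ ∃ i < D * m, A y = σ^[i] y} =
        ⋃ i ∈ I, {y | y ∈ Y ∧ A y = σ^[i] y ∧ minimalPeriod σ y = m * D} := by
      ext y
      simp only [Set.mem_ofPred_eq, Set.mem_iUnion, hI, Finset.mem_filter, Finset.mem_range]
      constructor
      · rintro ⟨hy, hp, i, hi, h⟩
        refine ⟨i, ⟨hi, ?_⟩, hy, h, by rw [hp, mul_comm]⟩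
        have := hdiv y hy hp i h
        have h2 := Nat.div_mul_cancel (Nat.gcd_dvd_left (D * m) i)
        rw [this] at h2
        exact Nat.eq_of_mul_eq_mul_left hD h2
      · rintro ⟨i, ⟨hi, _⟩, hy, h, hp⟩
        exact ⟨hy, by rw [hp, mul_comm], i, hi, h⟩
    have hcard : ∀ i ∈ I, {y | y ∈ Y ∧ A y = σ^[i] y ∧ minimalPeriod σ y = m * D}.Finite ∧
        ({y | y ∈ Y ∧ A y = σ^[i] y ∧ minimalPeriod σ y = m * D}.ncard : ℤ) =
        ∑ d ∈ m.divisors with Nat.gcd d D = 1, moebius d * T (D * m / (D * d)) := by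
      intro i hi
      obtain ⟨e, heD, h⟩ := hper i hi
      rw [h]
      refine ⟨(hfin e m hm heD).subset fun y hy => ⟨hy.1, hy.2.1⟩, ?_⟩
      rw [ncard_minimalPeriod_eq (T := T) (hc.iterate_left e) hD ?_ ?_ ?_ hm]
      · refine Finset.sum_congr rfl fun d _ => ?_
        rw [Nat.mul_div_mul_left _ _ hD]
      · intro y hy k
        rw [← iterate_mul, hA y hy, heD.symm.dvd_mul_left]
      · intro e' w hw he'
        simpa only [← iterate_mul] using hfin (e * e') w hw (Nat.Coprime.mul_left heD he')
      · intro e' w hw he'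
        simpa only [← iterate_mul] using hT (e * e') w hw (Nat.Coprime.mul_left heD he')
    rw [hset]
    classical
    rw [← hcardI]
    have hdisj : (I : Set ℕ).PairwiseDisjoint fun i =>
        {y | y ∈ Y ∧ A y = σ^[i] y ∧ minimalPeriod σ y = m * D} := by
      intro i hi j hj hij
      rw [Function.onFun, Set.disjoint_left]
      rintro y ⟨_, h1, hp⟩ ⟨_, h2, _⟩
      apply hij
      simp only [hI, Finset.coe_filter, Finset.mem_range, Set.mem_ofPred_eq] at hi hj
      rw [mul_comm] at hp
      exact (iterate_injOn_Iio_minimalPeriod (f := σ) (x := y)) (by simpa [hp] using hi.1)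
        (by simpa [hp] using hj.1) (h1.symm.trans h2)
    rw [← nsmul_eq_mul, ← Finset.sum_const, ← Finset.sum_congr rfl fun i hi => (hcard i hi).2,
      ← Nat.cast_sum]
    congr 1
    have := I.finite_toSet.ncard_biUnion (fun i hi => (hcard i hi).1) hdisj
    rw [← finsum_mem_coe_finset]
    exact this
  · have : {y | y ∈ Y ∧ minimalPeriod σ y = r ∧ ∃ i < r, A y = σ^[i] y} = ∅ := by
      ext y
      simp only [Set.mem_ofPred_eq, Set.mem_empty_iff_false, iff_false]
      rintro ⟨hy, hp, i, _, h⟩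
      apply hDr
      rw [← hdiv y hy hp i h]
      exact Nat.div_dvd_of_dvd (Nat.gcd_dvd_left r i)
    rw [this]
    simp

end Periods

/-! ### Frobenius orbits and roots of irreducible polynomials -/

section Frobenius

variable (F : Type*) [Field F] [Fintype F] (K : Type*) [Field K] [Algebra F K]

/-- The `|F|`-power Frobenius on the projective line over an extension of `F`. -/
def projFrob : OnePoint K → OnePoint K :=
  OnePoint.map (FiniteField.frobeniusAlgHom F K)

variable {K}

lemma iterate_frobenius_apply (w : ℕ) (x : K) :
    (FiniteField.frobeniusAlgHom F K)^[w] x = x ^ Fintype.card F ^ w := by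
  rw [FiniteField.coe_frobeniusAlgHom, pow_iterate]

lemma iterate_projFrob_coe (w : ℕ) (x : K) :
    (projFrob F K)^[w] x = ((x ^ Fintype.card F ^ w : K) : OnePoint K) := by
  rw [← iterate_frobenius_apply]
  have : Semiconj ((↑) : K → OnePoint K) (FiniteField.frobeniusAlgHom F K) (projFrob F K) :=
    fun x => rfl
  exact ((this.iterate_right w).eq x).symm

lemma iterate_projFrob_infty (w : ℕ) : (projFrob F K)^[w] OnePoint.infty = OnePoint.infty :=
  iterate_fixed rfl w

lemma minimalPeriod_projFrob_infty :
    minimalPeriod (projFrob F K) OnePoint.infty = 1 :=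
  minimalPeriod_eq_one_iff_isFixedPt.2 rfl

lemma minimalPeriod_projFrob_coe (x : K) :
    minimalPeriod (projFrob F K) x = minimalPeriod (FiniteField.frobeniusAlgHom F K) x := by
  apply minimalPeriod_eq_minimalPeriod_iff.2
  intro n
  rw [IsPeriodicPt, IsFixedPt, IsPeriodicPt, IsFixedPt, iterate_projFrob_coe,
    iterate_frobenius_apply, OnePoint.coe_eq_coe]

lemma minimalPeriod_frobenius [Algebra.IsAlgebraic F K] (x : K) :
    minimalPeriod (FiniteField.frobeniusAlgHom F K) x = (minpoly F x).natDegree := by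
  have hx : IsIntegral F x := Algebra.IsIntegral.isIntegral x
  have key : ∀ n, minimalPeriod (FiniteField.frobeniusAlgHom F K) x ∣ n ↔
      (minpoly F x).natDegree ∣ n := by
    intro n
    rw [← isPeriodicPt_iff_minimalPeriod_dvd, IsPeriodicPt, IsFixedPt, iterate_frobenius_apply,
      (minpoly.irreducible hx).natDegree_dvd_iff_dvd_X_pow_card_pow_sub_X, minpoly.dvd_iff,
      Nat.card_eq_fintype_card]
    simp [sub_eq_zero]
  exact Nat.dvd_antisymm ((key _).2 dvd_rfl) ((key _).1 dvd_rfl)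

lemma ncard_rootSet_of_irreducible [IsAlgClosed K] {f : F[X]} (hf : Irreducible f) :
    (f.rootSet K).ncard = f.natDegree := by
  rw [← Nat.card_coe_set_eq, Nat.card_eq_fintype_card]
  exact card_rootSet_eq_natDegree (PerfectField.separable_of_irreducible hf) (IsAlgClosed.splits _)

/-- The roots of an irreducible polynomial over a finite field form one Frobenius orbit. -/
lemma aeval_eq_zero_iff_exists_frobenius [IsAlgClosed K] {f : F[X]} (hf : Irreducible f) {x : K}
    (hx : aeval x f = 0) (y : K) :
    aeval y f = 0 ↔ ∃ i < f.natDegree, y = x ^ Fintype.card F ^ i := by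
  classical
  have hper : minimalPeriod (FiniteField.frobeniusAlgHom F K) x = f.natDegree := by
    have hint : IsAlgebraic F x := ⟨f, hf.ne_zero, hx⟩
    have key : ∀ n, minimalPeriod (FiniteField.frobeniusAlgHom F K) x ∣ n ↔
        f.natDegree ∣ n := by
      intro n
      have h := minpoly.dvd F x hx
      have hass : Associated (minpoly F x) f :=
        (minpoly.irreducible hint.isIntegral).associated_of_dvd hf h
      rw [← isPeriodicPt_iff_minimalPeriod_dvd, IsPeriodicPt, IsFixedPt, iterate_frobenius_apply,
        hf.natDegree_dvd_iff_dvd_X_pow_card_pow_sub_X, ← hass.dvd_iff_dvd_left, minpoly.dvd_iff,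
        Nat.card_eq_fintype_card]
      simp [sub_eq_zero]
    exact Nat.dvd_antisymm ((key _).2 dvd_rfl) ((key _).1 dvd_rfl)
  have hroot : ∀ i, aeval (x ^ Fintype.card F ^ i) f = 0 := by
    intro i
    have h := congrArg ((FiniteField.frobeniusAlgHom F K) ^ i) hx
    rw [← aeval_algHom_apply, _root_.map_zero, AlgHom.coe_pow, iterate_frobenius_apply] at h
    exact h
  refine ⟨fun hy => ?_, fun ⟨i, _, h⟩ => h ▸ hroot i⟩
  -- The conjugates of `x` are `deg f` distinct roots of `f`, hence all of them.
  set R := (Finset.range f.natDegree).image fun i => x ^ Fintype.card F ^ i with hR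
  have hsub : (R : Set K) ⊆ f.rootSet K := by
    intro z hz
    simp only [hR, Finset.coe_image, Set.mem_image] at hz
    obtain ⟨i, _, rfl⟩ := hz
    exact (mem_rootSet_of_ne hf.ne_zero).2 (hroot i)
  have hcard : (R : Set K).ncard = f.natDegree := by
    rw [Set.ncard_coe_finset, hR, Finset.card_image_of_injOn, Finset.card_range]
    intro i hi j hj hij
    simp only [Finset.coe_range, Set.mem_Iio] at hi hj
    refine (iterate_injOn_Iio_minimalPeriod (f := FiniteField.frobeniusAlgHom F K) (x := x))
      (by simpa [hper] using hi) (by simpa [hper] using hj) ?_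
    simpa only [iterate_frobenius_apply] using hij
  have heq : (R : Set K) = f.rootSet K :=
    Set.eq_of_subset_of_ncard_le hsub (by rw [hcard, ncard_rootSet_of_irreducible F hf])
      (rootSet_finite f K)
  have hyR : y ∈ (R : Set K) := heq ▸ (mem_rootSet_of_ne hf.ne_zero).2 hy
  simp only [hR, Finset.coe_image, Set.mem_image, Finset.coe_range, Set.mem_Iio] at hyR
  obtain ⟨i, hi, h⟩ := hyR
  exact ⟨i, hi, h.symm⟩

instance finite_monicIrred (r : ℕ) : Finite (MonicIrred F r) := by
  have : Finite (degreeLT F (r + 1)) := Module.finite_of_finite F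
  refine Finite.of_injective
    (fun f : MonicIrred F r => (⟨f.1, ?_⟩ : degreeLT F (r + 1))) ?_
  · rw [mem_degreeLT, Polynomial.degree_lt_iff_coeff_zero]
    intro m hm
    exact coeff_eq_zero_of_natDegree_lt (by rw [f.2.2.2]; omega)
  · intro f g h
    exact Subtype.ext (congrArg (fun z : degreeLT F (r + 1) => z.1) h)

-- A monic irreducible polynomial is the minimal polynomial of each of its roots, so distinct ones
-- have disjoint root sets. By separability each root set has `r` elements.
variable (K) in
lemma mul_ncard_eq_ncard_roots [IsAlgClosed K] {r : ℕ} (S : Set (MonicIrred F r)) :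
    r * S.ncard = {x : K | ∃ f ∈ S, aeval x f.1 = 0}.ncard := by
  have hU : {x : K | ∃ f ∈ S, aeval x f.1 = 0} = ⋃ f ∈ S, f.1.rootSet K := by
    ext x
    simp only [Set.mem_ofPred_eq, Set.mem_iUnion, exists_prop]
    refine exists_congr fun f => and_congr_right fun _ => ?_
    rw [mem_rootSet_of_ne f.2.2.1.ne_zero]
  rw [hU, (Set.toFinite S).ncard_biUnion (fun f _ => rootSet_finite f.1 K)]
  · rw [finsum_mem_congr rfl (fun f _ => (ncard_rootSet_of_irreducible F f.2.2.1).trans f.2.2.2),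
      finsum_mem_eq_finite_toFinset_sum _ (Set.toFinite S), Finset.sum_const, smul_eq_mul,
      mul_comm, Set.ncard_eq_toFinset_card S]
  · intro f _ g _ hfg
    rw [Function.onFun, Set.disjoint_left]
    intro x hx hx'
    rw [mem_rootSet_of_ne f.2.2.1.ne_zero] at hx
    rw [mem_rootSet_of_ne g.2.2.1.ne_zero] at hx'
    refine hfg (Subtype.ext ?_)
    rw [minpoly.eq_of_irreducible_of_monic f.2.2.1 hx f.2.1,
      minpoly.eq_of_irreducible_of_monic g.2.2.1 hx' g.2.1]

variable (K) in
lemma mul_card_monicIrred [IsAlgClosed K] [Algebra.IsAlgebraic F K] (r : ℕ) :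
    r * Nat.card (MonicIrred F r) =
      {x : K | minimalPeriod (FiniteField.frobeniusAlgHom F K) x = r}.ncard := by
  rw [← Set.ncard_univ, mul_ncard_eq_ncard_roots F K]
  congr 1
  ext x
  simp only [Set.mem_univ, true_and, Set.mem_ofPred_eq, minimalPeriod_frobenius]
  constructor
  · rintro ⟨f, hf⟩
    rw [← minpoly.eq_of_irreducible_of_monic f.2.2.1 hf f.2.1, f.2.2.2]
  · intro h
    have hx : IsIntegral F x := Algebra.IsIntegral.isIntegral x
    exact ⟨⟨minpoly F x, minpoly.monic hx, minpoly.irreducible hx, h⟩, minpoly.aeval F x⟩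

end Frobenius

/-! ### The action on roots -/

section Action

variable {F : Type*} [Field F] {K : Type*} [Field K] [Algebra F K]

/-- The substitution inside `mobiusSubst` is the inverse Möbius map, so evaluating at `A x` gives
back `f(x)` up to an automorphy factor. Roots of `f` are thus carried by `A` to roots of the
transformed polynomial. -/
lemma aeval_mobiusSubst (r : ℕ) (A : Matrix (Fin 2) (Fin 2) F) {x : K} (f : F[X])
    (hf : f.natDegree ≤ r)
    (hx : algebraMap F K (A 1 0) * x + algebraMap F K (A 1 1) ≠ 0) :
    aeval ((algebraMap F K (A 0 0) * x + algebraMap F K (A 0 1)) /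
      (algebraMap F K (A 1 0) * x + algebraMap F K (A 1 1))) (mobiusSubst r A f) =
      (algebraMap F K A.det / (algebraMap F K (A 1 0) * x + algebraMap F K (A 1 1))) ^ r *
        aeval x f := by
  rw [mobiusSubst, map_sum, aeval_eq_sum_range' (Nat.lt_succ_of_le hf), Finset.mul_sum]
  refine Finset.sum_congr rfl fun i hi => ?_
  have hi' : i ≤ r := by simpa [Nat.lt_succ_iff] using hi
  simp only [map_mul, map_pow, map_sub, aeval_C, aeval_X, Algebra.smul_def, Matrix.det_fin_two]
  generalize algebraMap F K (A 0 0) = a at *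
  generalize algebraMap F K (A 0 1) = b at *
  generalize algebraMap F K (A 1 0) = c at *
  generalize algebraMap F K (A 1 1) = d at *
  have h1 : d * ((a * x + b) / (c * x + d)) - b = (a * d - b * c) / (c * x + d) * x := by
    rw [div_mul_eq_mul_div, mul_div_assoc', div_sub' hx]
    ring
  have h2 : a - c * ((a * x + b) / (c * x + d)) = (a * d - b * c) / (c * x + d) := by
    field_simp
    ring
  have h3 : ((a * d - b * c) / (c * x + d)) ^ r =
      ((a * d - b * c) / (c * x + d)) ^ i * ((a * d - b * c) / (c * x + d)) ^ (r - i) := by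
    rw [← pow_add]; congr 1; omega
  rw [h1, h2, h3, mul_pow]
  ring

/-- A root of an irreducible polynomial of degree at least 2 satisfies no nonzero linear equation
over `F`, and the bottom row of `A` is nonzero. -/
lemma den_ne_zero_of_natDegree {r : ℕ} (hr : 2 ≤ r) (A : GL (Fin 2) F) {f : F[X]}
    (hf : Irreducible f) (hd : f.natDegree = r) {x : K} (hx : aeval x f = 0) :
    algebraMap F K (A 1 0) * x + algebraMap F K (A 1 1) ≠ 0 := by
  intro h
  have hg : aeval x (C (A 1 0) * X + C (A 1 1)) = 0 := by simpa using h
  have hass : Associated (minpoly F x) f :=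
    (minpoly.irreducible (IsAlgebraic.isIntegral ⟨f, hf.ne_zero, hx⟩)).associated_of_dvd hf
      (minpoly.dvd F x hx)
  have hdvd := minpoly.dvd F x hg
  have h0 : (C (A 1 0) * X + C (A 1 1) : F[X]) = 0 := by
    by_contra hne
    have h1 := natDegree_le_of_dvd hdvd hne
    have h2 : (C (A 1 0) * X + C (A 1 1) : F[X]).natDegree ≤ 1 := by compute_degree
    have h3 := natDegree_eq_of_degree_eq (degree_eq_degree_of_associated hass)
    omega
  have e0 := congrArg (fun p => coeff p 0) h0
  have e1 := congrArg (fun p => coeff p 1) h0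
  simp [coeff_C] at e0 e1
  have := A.det.ne_zero
  apply this
  simp [Matrix.det_fin_two, e0, e1]

variable [DecidableEq K]

variable (K) in
/-- The action of `GL₂(F)` on the projective line over an extension of `F`. -/
def projAct (A : GL (Fin 2) F) : OnePoint K → OnePoint K :=
  fun x => A.map (algebraMap F K) • x

lemma projAct_infty (A : GL (Fin 2) F) : projAct K A OnePoint.infty =
    if algebraMap F K (A 1 0) = 0 then OnePoint.infty
    else ((algebraMap F K (A 0 0) / algebraMap F K (A 1 0) : K) : OnePoint K) := by
  rw [projAct, OnePoint.smul_infty_eq_ite]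
  rfl

lemma projAct_coe (A : GL (Fin 2) F) (x : K) : projAct K A x =
    if algebraMap F K (A 1 0) * x + algebraMap F K (A 1 1) = 0 then OnePoint.infty
    else (((algebraMap F K (A 0 0) * x + algebraMap F K (A 0 1)) /
      (algebraMap F K (A 1 0) * x + algebraMap F K (A 1 1)) : K) : OnePoint K) := by
  simp [projAct, OnePoint.smul_some_eq_ite]

lemma iterate_projAct (A : GL (Fin 2) F) (k : ℕ) : (projAct K A)^[k] = projAct K (A ^ k) := by
  induction k with
  | zero => funext x; simp [projAct]
  | succ k ih =>
    funext x
    rw [iterate_succ_apply', ih, pow_succ']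
    simp [projAct, mul_smul]

/-- The entries of `A` lie in `F`, so Frobenius fixes them. -/
lemma projAct_commute_projFrob [Fintype F] (A : GL (Fin 2) F) :
    Function.Commute (projAct K A) (projFrob F K) := by
  intro x
  have h := OnePoint.map_smul (FiniteField.frobeniusAlgHom F K : K →+* K)
    (A.map (algebraMap F K)) x
  have h2 : (A.map (algebraMap F K)).map (FiniteField.frobeniusAlgHom F K : K →+* K) =
      A.map (algebraMap F K) := by
    ext i j
    simp
  rw [h2] at h
  exact h.symm

/-- `A` fixes `f` if and only if it maps a root of `f` to one of its Frobenius conjugates. -/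
lemma makeMonic_mobiusSubst_eq_iff [Fintype F] [IsAlgClosed K] {r : ℕ} (hr : 2 ≤ r)
    (A : GL (Fin 2) F) (f : MonicIrred F r) {x : K} (hx : aeval x f.1 = 0) :
    makeMonic (mobiusSubst r A.1 f.1) = f.1 ↔
      ∃ i < r, projAct K A x = (projFrob F K)^[i] x := by
  let := glAction F r hr
  have hden := den_ne_zero_of_natDegree hr A f.2.2.1 f.2.2.2 hx
  rw [projAct_coe, if_neg hden]
  simp only [iterate_projFrob_coe, OnePoint.coe_eq_coe]
  set y := (algebraMap F K (A 0 0) * x + algebraMap F K (A 0 1)) /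
      (algebraMap F K (A 1 0) * x + algebraMap F K (A 1 1)) with hy
  have hroot : aeval y (makeMonic (mobiusSubst r A.1 f.1)) = 0 := by
    have := aeval_mobiusSubst r A.1 f.1 f.2.2.2.le hden
    rw [makeMonic, map_mul, hy, this, hx, mul_zero, mul_zero]
  have h := aeval_eq_zero_iff_exists_frobenius F f.2.2.1 hx y
  rw [f.2.2.2] at h
  rw [← h]
  constructor
  · intro h1
    rwa [h1] at hroot
  · intro h1
    have hA := (A • f).2
    have e : (A • f).1 = makeMonic (mobiusSubst r A.1 f.1) := rfl
    rw [e] at hA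
    exact (minpoly.eq_of_irreducible_of_monic hA.2.1 hroot hA.1).trans
      (minpoly.eq_of_irreducible_of_monic f.2.2.1 h1 f.2.1).symm

-- This turns the Burnside count into a count of points. The point at infinity never contributes,
-- having period 1.
variable (K) in
lemma mul_ncard_fixed [Fintype F] [IsAlgClosed K] [Algebra.IsAlgebraic F K] {r : ℕ} (hr : 2 ≤ r)
    (A : GL (Fin 2) F) :
    r * {f : MonicIrred F r | makeMonic (mobiusSubst r A.1 f.1) = f.1}.ncard =
      {x : OnePoint K | minimalPeriod (projFrob F K) x = r ∧
        ∃ i < r, projAct K A x = (projFrob F K)^[i] x}.ncard := by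
  rw [mul_ncard_eq_ncard_roots F K, ← Set.ncard_image_of_injective _ OnePoint.coe_injective]
  congr 1
  ext x
  induction x using OnePoint.rec with
  | infty =>
    simp only [Set.mem_image, Set.mem_ofPred_eq, minimalPeriod_projFrob_infty,
      OnePoint.coe_ne_infty, and_false, exists_false, false_iff]
    omega
  | coe x =>
    simp only [Set.mem_image, Set.mem_ofPred_eq, OnePoint.coe_eq_coe, exists_eq_right,
      minimalPeriod_projFrob_coe, minimalPeriod_frobenius]
    constructor
    · rintro ⟨f, hf, hx⟩
      refine ⟨?_, (makeMonic_mobiusSubst_eq_iff hr A f hx).1 hf⟩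
      rw [← minpoly.eq_of_irreducible_of_monic f.2.2.1 hx f.2.1, f.2.2.2]
    · rintro ⟨hd, h⟩
      have hx : IsIntegral F x := Algebra.IsIntegral.isIntegral x
      set f : MonicIrred F r := ⟨minpoly F x, minpoly.monic hx, minpoly.irreducible hx, hd⟩
      have hx : aeval x f.1 = 0 := minpoly.aeval F x
      exact ⟨f, (makeMonic_mobiusSubst_eq_iff hr A f hx).2 h, hx⟩

end Action

/-! ### Orders, fixed points and twisted Frobenius equations -/

section FixedPoints

variable {F : Type*} [Field F] {K : Type*} [Field K] [Algebra F K]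

/-- The matrix `A` is not a scalar matrix. -/
def NonScalar (A : GL (Fin 2) F) : Prop :=
  ¬ (A 0 1 = 0 ∧ A 1 0 = 0 ∧ A 0 0 = A 1 1)

/-- `l` and `m` are the two eigenvalues of `A` in `K`, with multiplicity. -/
structure IsEigenPair (A : GL (Fin 2) F) (l m : K) : Prop where
  add_eq : l + m = algebraMap F K (A 0 0 + A 1 1)
  mul_eq : l * m = algebraMap F K (A 0 0 * A 1 1 - A 0 1 * A 1 0)

lemma det_entries_ne_zero (A : GL (Fin 2) F) : A 0 0 * A 1 1 - A 0 1 * A 1 0 ≠ 0 := by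
  rw [← Matrix.det_fin_two]
  exact A.det.ne_zero

lemma algebraMap_det_ne_zero (A : GL (Fin 2) F) :
    algebraMap F K (A 0 0) * algebraMap F K (A 1 1) -
      algebraMap F K (A 0 1) * algebraMap F K (A 1 0) ≠ 0 := by
  rw [← map_mul, ← map_mul, ← map_sub]
  exact (_root_.map_ne_zero _).2 (det_entries_ne_zero A)

lemma IsEigenPair.left_ne_zero {A : GL (Fin 2) F} {l m : K} (h : IsEigenPair A l m) : l ≠ 0 := by
  rintro rfl
  have := h.mul_eq
  rw [zero_mul, eq_comm, _root_.map_eq_zero] at this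
  exact det_entries_ne_zero A this

lemma IsEigenPair.symm {A : GL (Fin 2) F} {l m : K} (h : IsEigenPair A l m) :
    IsEigenPair A m l :=
  ⟨by rw [add_comm, h.add_eq], by rw [mul_comm, h.mul_eq]⟩

/-- The powers of a `2 × 2` matrix are linear combinations of the matrix and the identity. -/
lemma IsEigenPair.exists_pow_eq {A : GL (Fin 2) F} {l m : K} (h : IsEigenPair A l m) (k : ℕ) :
    ∃ u v : K, (∀ i j, algebraMap F K ((A ^ k) i j) =
        u * algebraMap F K (A i j) + v * (if i = j then 1 else 0)) ∧
      u * l + v = l ^ k ∧ u * m + v = m ^ k ∧ (l = m → l * u = k * l ^ k) := by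
  induction k with
  | zero =>
    refine ⟨0, 1, fun i j => ?_, by simp, by simp, by simp⟩
    by_cases hij : i = j <;> simp [hij]
  | succ k ih =>
    obtain ⟨u, v, h1, h2, h3, h4⟩ := ih
    have ha := h.add_eq
    have hm := h.mul_eq
    simp only [map_add, map_sub, map_mul] at ha hm
    -- Cayley–Hamilton, `A² = (l + m) A - l m`, applied to `A (u A + v)`. In the repeated case `u`
    -- is `k l^(k-1)`, the derivative of the `k`-th power at `l`.
    refine ⟨u * (l + m) + v, -(l * m) * u, fun i j => ?_, ?_, ?_, ?_⟩
    · rw [pow_succ]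
      simp only [Matrix.GeneralLinearGroup.coe_mul, Matrix.mul_apply, Fin.sum_univ_two, map_add,
        map_mul, h1, ha, hm]
      fin_cases i <;> fin_cases j <;> simp <;> ring
    · rw [pow_succ, ← h2]; ring
    · rw [pow_succ, ← h3]; ring
    · rintro rfl
      push_cast
      linear_combination l * h4 rfl + l * h2

lemma makeMonic_mobiusSubst_of_not_nonScalar {r : ℕ} {A : GL (Fin 2) F}
    (hA : ¬ NonScalar A) (f : MonicIrred F r) : makeMonic (mobiusSubst r A.1 f.1) = f.1 := by
  obtain ⟨h1, h2, h3⟩ := not_not.1 hA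
  have h0 : A 0 0 ≠ 0 := by
    intro h0
    apply det_entries_ne_zero A
    rw [h0, h1]; ring
  have e : A.1 = Matrix.scalar (Fin 2) (A 0 0) := by
    ext i j
    fin_cases i <;> fin_cases j <;> simp [h1, h2, h3]
  rw [e, mobiusSubst_scalar _ f.2.2.2.le, makeMonic_C_mul (pow_ne_zero _ h0),
    makeMonic_of_monic f.2.1]

variable [DecidableEq K]

lemma projAct_infty_eq_self_iff (A : GL (Fin 2) F) :
    projAct K A OnePoint.infty = OnePoint.infty ↔ algebraMap F K (A 1 0) = 0 := by
  rw [projAct_infty]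
  split_ifs with h <;> simp [h]

/-- Clearing the denominator is harmless at the pole too: numerator and denominator cannot vanish
together as the determinant is nonzero, so there both sides are false. -/
lemma projAct_coe_eq_coe_iff (A : GL (Fin 2) F) (x y : K) :
    projAct K A x = y ↔ y * (algebraMap F K (A 1 0) * x + algebraMap F K (A 1 1)) =
      algebraMap F K (A 0 0) * x + algebraMap F K (A 0 1) := by
  rw [projAct_coe]
  have hdet := algebraMap_det_ne_zero (K := K) A
  split_ifs with h
  · simp only [OnePoint.infty_ne_coe, h, mul_zero, false_iff]
    intro h0
    apply hdet
    by_cases hc : algebraMap F K (A 1 0) = 0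
    · rw [hc, zero_mul, zero_add] at h
      rw [hc, h]; ring
    · apply mul_left_cancel₀ hc
      linear_combination (algebraMap F K (A 0 0) * algebraMap F K (A 1 0)) * h
        - algebraMap F K (A 1 0) ^ 2 * (- h0)
  · rw [OnePoint.coe_eq_coe, div_eq_iff h, eq_comm]

lemma projAct_coe_eq_self_iff (A : GL (Fin 2) F) (x : K) :
    projAct K A x = x ↔ algebraMap F K (A 1 0) * x ^ 2 +
      (algebraMap F K (A 1 1) - algebraMap F K (A 0 0)) * x - algebraMap F K (A 0 1) = 0 := by
  rw [projAct_coe_eq_coe_iff]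
  constructor <;> intro h <;> linear_combination h

/-- The fixed-point equation of `u A + v` is `u` times that of `A`. So a power of `A` fixes either
everything or only what `A` fixes. -/
lemma projAct_pow_eq_self_iff {A : GL (Fin 2) F} {k : ℕ} {u v : K}
    (h : ∀ i j, algebraMap F K ((A ^ k) i j) =
        u * algebraMap F K (A i j) + v * (if i = j then 1 else 0)) (x : OnePoint K) :
    projAct K (A ^ k) x = x ↔ u = 0 ∨ projAct K A x = x := by
  induction x using OnePoint.rec with
  | infty =>
    rw [projAct_infty_eq_self_iff, projAct_infty_eq_self_iff, h]
    simp
  | coe x =>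
    rw [projAct_coe_eq_self_iff, projAct_coe_eq_self_iff, ← mul_eq_zero]
    simp only [h]
    simp only [Fin.isValue, ↓reduceIte, zero_ne_one, one_ne_zero]
    constructor <;> intro h <;> linear_combination h

/-- Here `u (l - m) = l^k - m^k`, so `u` vanishes exactly when `(l / m)^k = 1`. -/
lemma IsEigenPair.iterate_eq_self_iff_of_ne {A : GL (Fin 2) F} {l m : K}
    (h : IsEigenPair A l m) (hlm : l ≠ m) {x : OnePoint K} (hx : projAct K A x ≠ x) (k : ℕ) :
    (projAct K A)^[k] x = x ↔ orderOf (l / m) ∣ k := by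
  obtain ⟨u, v, h1, h2, h3, -⟩ := h.exists_pow_eq k
  rw [iterate_projAct, projAct_pow_eq_self_iff h1, or_iff_left hx, orderOf_dvd_iff_pow_eq_one,
    div_pow, div_eq_one_iff_eq (pow_ne_zero _ h.symm.left_ne_zero), ← h2, ← h3]
  constructor
  · rintro rfl; ring
  · intro h4
    have : u * (l - m) = 0 := by linear_combination h4
    exact (mul_eq_zero.1 this).resolve_right (sub_ne_zero.2 hlm)

/-- Here `l u = k l^k`, which vanishes exactly when `k = 0` in `K`, that is, for even `k`. -/
lemma IsEigenPair.iterate_eq_self_iff_of_eq [CharP K 2] {A : GL (Fin 2) F} {l : K}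
    (h : IsEigenPair A l l) {x : OnePoint K} (hx : projAct K A x ≠ x) (k : ℕ) :
    (projAct K A)^[k] x = x ↔ 2 ∣ k := by
  obtain ⟨u, v, h1, -, -, h4⟩ := h.exists_pow_eq k
  have hl := h.left_ne_zero
  rw [iterate_projAct, projAct_pow_eq_self_iff h1, or_iff_left hx,
    ← CharP.cast_eq_zero_iff K 2 k]
  have h4 := h4 rfl
  constructor
  · rintro rfl
    rw [mul_zero, eq_comm] at h4
    exact (mul_eq_zero.1 h4).resolve_right (pow_ne_zero _ hl)
  · intro hk
    rw [hk, zero_mul] at h4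
    exact (mul_eq_zero.1 h4).resolve_left hl

/-- At a fixed point `(x, 1)` is an eigenvector, with eigenvalue `c x + d`, where `(c, d)` is the
bottom row. -/
lemma IsEigenPair.fixed_coe_iff {A : GL (Fin 2) F} {l m : K} (h : IsEigenPair A l m)
    (hc : algebraMap F K (A 1 0) ≠ 0) (x : K) : projAct K A x = x ↔
      x = (l - algebraMap F K (A 1 1)) / algebraMap F K (A 1 0) ∨
      x = (m - algebraMap F K (A 1 1)) / algebraMap F K (A 1 0) := by
  have ha := h.add_eq
  have hm := h.mul_eq
  simp only [map_add, map_sub, map_mul] at ha hm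
  rw [projAct_coe_eq_self_iff, eq_div_iff hc, eq_div_iff hc, ← sub_eq_zero (b := l - _),
    ← sub_eq_zero (b := m - _), ← mul_eq_zero]
  constructor
  · intro h
    linear_combination algebraMap F K (A 1 0) * h -
      (x * algebraMap F K (A 1 0) + algebraMap F K (A 1 1)) * ha + hm
  · intro h
    apply mul_left_cancel₀ hc
    linear_combination h +
      (x * algebraMap F K (A 1 0) + algebraMap F K (A 1 1)) * ha - hm

lemma IsEigenPair.fixed_eq_of_ne_zero {A : GL (Fin 2) F} {l m : K} (h : IsEigenPair A l m)
    (hc : algebraMap F K (A 1 0) ≠ 0) : {x : OnePoint K | projAct K A x = x} =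
      {(((l - algebraMap F K (A 1 1)) / algebraMap F K (A 1 0) : K) : OnePoint K),
       (((m - algebraMap F K (A 1 1)) / algebraMap F K (A 1 0) : K) : OnePoint K)} := by
  ext x
  induction x using OnePoint.rec with
  | infty => simp [projAct_infty_eq_self_iff, hc]
  | coe x => simp [h.fixed_coe_iff hc]

/-- A finite fixed point is a root of a quadratic over `F` that is nonzero because `A` is not
scalar. For `r ≥ 3` such points can be discarded. -/
lemma minimalPeriod_le_two_of_fixed [Fintype F] [Algebra.IsAlgebraic F K] {A : GL (Fin 2) F}
    (hA : NonScalar A) {x : OnePoint K} (hx : projAct K A x = x) :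
    minimalPeriod (projFrob F K) x ≤ 2 := by
  induction x using OnePoint.rec with
  | infty => rw [minimalPeriod_projFrob_infty]; norm_num
  | coe x =>
    rw [minimalPeriod_projFrob_coe, minimalPeriod_frobenius]
    rw [projAct_coe_eq_self_iff] at hx
    set p : F[X] := C (A 1 0) * X ^ 2 + C (A 1 1 - A 0 0) * X + C (-A 0 1) with hp
    have hp0 : p ≠ 0 := by
      intro h0
      apply hA
      have e0 := congrArg (fun p => coeff p 0) h0
      have e1 := congrArg (fun p => coeff p 1) h0
      have e2 := congrArg (fun p => coeff p 2) h0
      simp [hp, coeff_C, coeff_X] at e0 e1 e2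
      exact ⟨e0, e2, (sub_eq_zero.1 e1).symm⟩
    have hpx : aeval x p = 0 := by
      rw [← hx, hp]
      simp only [map_add, map_mul, aeval_C, map_pow, aeval_X, map_sub, map_neg]
      ring
    exact (natDegree_le_of_dvd (minpoly.dvd F x hpx) hp0).trans natDegree_quadratic_le

/-- Every twisted form of Frobenius has `q ^ w + 1` fixed points on the projective line. -/
lemma ncard_projAct_eq_frob [Fintype F] [IsAlgClosed K] (A : GL (Fin 2) F) {w : ℕ} (hw : 0 < w) :
    {x : OnePoint K | projAct K A x = (projFrob F K)^[w] x}.Finite ∧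
    {x : OnePoint K | projAct K A x = (projFrob F K)^[w] x}.ncard = Fintype.card F ^ w + 1 := by
  have hdet := algebraMap_det_ne_zero (K := K) A
  have hinf := projAct_infty_eq_self_iff (K := K) A
  have hcoe := projAct_coe_eq_coe_iff (K := K) A
  set Q := Fintype.card F ^ w with hQ
  have hQ2 : 1 < Q := Nat.one_lt_pow hw.ne' Fintype.one_lt_card
  have hQ0 : (Q : K) = 0 := by
    have h1 := congrArg (algebraMap F K) (FiniteField.cast_card_eq_zero F)
    rw [map_natCast, _root_.map_zero] at h1
    rw [hQ, Nat.cast_pow, h1, zero_pow hw.ne']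
  set a := algebraMap F K (A 0 0) with ha
  set b := algebraMap F K (A 0 1)
  set c := algebraMap F K (A 1 0)
  set d := algebraMap F K (A 1 1)
  -- The equation `x^Q = (a x + b) / (c x + d)`, cleared of its denominator.
  set P : K[X] := (C c * X + C d) * X ^ Q - (C a * X + C b) with hP
  have hlin : (C c * X + C d : K[X]) ≠ 0 := by
    intro h
    have e0 := congrArg (fun p => coeff p 0) h
    have e1 := congrArg (fun p => coeff p 1) h
    simp [coeff_C] at e0 e1
    apply hdet
    rw [e0, e1]; ring
  have hdeg : P.natDegree = (C c * X + C d : K[X]).natDegree + Q := by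
    have h1 : ((C c * X + C d) * X ^ Q : K[X]).natDegree =
        (C c * X + C d : K[X]).natDegree + Q := natDegree_mul_X_pow Q hlin
    have h2 : (C a * X + C b : K[X]).natDegree ≤ 1 := natDegree_linear_le
    rw [hP, natDegree_sub_eq_left_of_natDegree_lt (by omega), h1]
  have hP0 : P ≠ 0 := by
    rintro h
    rw [h, natDegree_zero] at hdeg
    omega
  have hsep : P.Separable := by
    have hder : derivative P = C c * X ^ Q - C a := by
      simp [hP, derivative_X_pow, hQ0]
    -- As `Q = 0` in `K`, one has `P' = c X^Q - a`, whence `c P - (c X + d) P' = a d - b c`, a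
    -- nonzero constant.
    refine ⟨C (c / (a * d - b * c)), -(C (1 / (a * d - b * c)) * (C c * X + C d)), ?_⟩
    have h1 : (C (1 / (a * d - b * c)) * (C a * C d - C b * C c) : K[X]) = 1 := by
      rw [← C_mul, ← C_mul, ← C_sub, ← C_mul, one_div, inv_mul_cancel₀ hdet, C_1]
    rw [hder, hP, div_eq_mul_one_div c, C_mul, ← h1]
    ring
  have hcard : (P.rootSet K).ncard = P.natDegree := by
    rw [← Nat.card_coe_set_eq, Nat.card_eq_fintype_card]
    exact card_rootSet_eq_natDegree hsep (IsAlgClosed.splits _)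
  have hroot : ∀ x : K, projAct K A x = (projFrob F K)^[w] x ↔ x ∈ P.rootSet K := by
    intro x
    rw [iterate_projFrob_coe, hcoe, mem_rootSet_of_ne hP0, hP]
    simp only [map_sub, map_mul, map_add, aeval_C, aeval_X, map_pow, Algebra.algebraMap_self_apply]
    rw [sub_eq_zero, mul_comm]
  have hfin := rootSet_finite P K
  have himg : ((↑) '' P.rootSet K : Set (OnePoint K)).ncard = P.natDegree := by
    rw [Set.ncard_image_of_injective _ OnePoint.coe_injective, hcard]
  -- For `c = 0` the degree of `P` drops to `Q`, but infinity becomes a solution. Otherwise the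
  -- degree is `Q + 1` and infinity is not one.
  by_cases hc : c = 0
  · have hset : {x : OnePoint K | projAct K A x = (projFrob F K)^[w] x} =
        insert OnePoint.infty ((↑) '' P.rootSet K) := by
      ext x
      induction x using OnePoint.rec with
      | infty => simpa [iterate_projFrob_infty] using hinf.2 hc
      | coe x => simp [hroot]
    rw [hset]
    refine ⟨(hfin.image _).insert _, ?_⟩
    rw [Set.ncard_insert_of_notMem (by simp) (hfin.image _), himg, hdeg, hc]
    simp
  · have hset : {x : OnePoint K | projAct K A x = (projFrob F K)^[w] x} =
        (↑) '' P.rootSet K := by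
      ext x
      induction x using OnePoint.rec with
      | infty => simp [iterate_projFrob_infty, hinf, hc]
      | coe x => simp [hroot]
    rw [hset]
    refine ⟨hfin.image _, ?_⟩
    rw [himg, hdeg, natDegree_linear hc, add_comm]

/-- The number of polynomials fixed by a nonscalar matrix, from its order in `PGL₂` and the number
of its fixed points over the extensions of `F`. -/
lemma mul_ncard_fixed_eq [Fintype F] [IsAlgClosed K] [Algebra.IsAlgebraic F K] {r : ℕ}
    (hr : 3 ≤ r) {A : GL (Fin 2) F} (hA : NonScalar A) {D : ℕ} (hD : 0 < D)
    (hord : ∀ x : OnePoint K, projAct K A x ≠ x → ∀ k, (projAct K A)^[k] x = x ↔ D ∣ k)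
    {c : ℕ → ℤ} (hc : ∀ w, 0 < w → ({x : OnePoint K | projAct K A x = x ∧
      (projFrob F K)^[w] x = x}.ncard : ℤ) = c w) :
    (r : ℤ) * {f : MonicIrred F r | makeMonic (mobiusSubst r A.1 f.1) = f.1}.ncard =
      if D ∣ r then Nat.totient D * ∑ d ∈ (r / D).divisors with Nat.gcd d D = 1,
        moebius d * (Fintype.card F ^ (r / (D * d)) + 1 - c (r / (D * d))) else 0 := by
  have h := mul_ncard_fixed K (by omega : 2 ≤ r) A
  have hset : {x : OnePoint K | minimalPeriod (projFrob F K) x = r ∧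
        ∃ i < r, projAct K A x = (projFrob F K)^[i] x} =
      {x | x ∈ {x | projAct K A x ≠ x} ∧ minimalPeriod (projFrob F K) x = r ∧
        ∃ i < r, projAct K A x = (projFrob F K)^[i] x} := by
    ext x
    simp only [Set.mem_ofPred_eq]
    refine ⟨fun hx => ⟨fun hfix => ?_, hx⟩, fun hx => hx.2⟩
    have := minimalPeriod_le_two_of_fixed hA hfix
    omega
  have hfin : ∀ e w, 0 < w → e.Coprime D → {y | y ∈ {x : OnePoint K | projAct K A x ≠ x} ∧
      (projAct K A)^[e] y = (projFrob F K)^[w] y}.Finite := by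
    intro e w hw _
    rw [iterate_projAct]
    exact (ncard_projAct_eq_frob (A ^ e) hw).1.subset fun x hx => hx.2
  rw [← Nat.cast_mul, h, hset, ncard_minimalPeriod_eq_and_exists
    (projAct_commute_projFrob A) (Y := {x | projAct K A x ≠ x}) hD hord
    (T := fun w => Fintype.card F ^ w + 1 - c w) hfin ?_ (by omega)]
  intro e w hw he
  obtain ⟨hf, hn⟩ := ncard_projAct_eq_frob (K := K) (A ^ e) hw
  -- A fixed point of `A` solves the equation exactly when `σ^w` fixes it. So the number of nonfixed
  -- solutions does not depend on `e`, as the sieve demands.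
  have hU : {x : OnePoint K | projAct K (A ^ e) x = (projFrob F K)^[w] x} =
      {y | y ∈ {x : OnePoint K | projAct K A x ≠ x} ∧
        (projAct K A)^[e] y = (projFrob F K)^[w] y} ∪
      {x : OnePoint K | projAct K A x = x ∧ (projFrob F K)^[w] x = x} := by
    ext x
    simp only [Set.mem_ofPred_eq, Set.mem_union, iterate_projAct]
    by_cases hx : projAct K A x = x
    · have : projAct K (A ^ e) x = x := by
        rw [← iterate_projAct]
        exact iterate_fixed hx e
      simp [hx, this, eq_comm]
    · simp [hx]
  have hdisj : Disjoint {y | y ∈ {x : OnePoint K | projAct K A x ≠ x} ∧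
        (projAct K A)^[e] y = (projFrob F K)^[w] y}
      {x : OnePoint K | projAct K A x = x ∧ (projFrob F K)^[w] x = x} :=
    Set.disjoint_left.2 fun x hx hx' => hx.1 hx'.1
  rw [hU] at hf hn
  rw [Set.ncard_union_eq hdisj (hf.subset Set.subset_union_left)
    (hf.subset Set.subset_union_right)] at hn
  have hn' := congrArg (Nat.cast : ℕ → ℤ) hn
  push_cast at hn'
  rw [hc w hw] at hn'
  linarith

end FixedPoints

/-! ### Fixed points over the extensions of `F` -/

section FixedPointCounts

variable {F : Type*} [Field F] [Fintype F] {K : Type*} [Field K] [Algebra F K]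

lemma algebraMap_pow_card_pow (z : F) (w : ℕ) :
    (algebraMap F K z) ^ Fintype.card F ^ w = algebraMap F K z := by
  rw [← map_pow, FiniteField.pow_card_pow]

lemma iterate_projFrob_algebraMap (z : F) (w : ℕ) :
    (projFrob F K)^[w] ((algebraMap F K z : K) : OnePoint K) = ((algebraMap F K z : K)) := by
  rw [iterate_projFrob_coe, algebraMap_pow_card_pow]

lemma sub_pow_card_pow (x y : K) (w : ℕ) :
    (x - y) ^ Fintype.card F ^ w = x ^ Fintype.card F ^ w - y ^ Fintype.card F ^ w := by
  simp only [← iterate_frobenius_apply]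
  rw [← AlgHom.coe_pow, map_sub]

/-- An upper triangular matrix over `F` has its eigenvalues in `F`. -/
lemma IsEigenPair.lowerLeft_ne_zero {A : GL (Fin 2) F} {l m : K} (h : IsEigenPair A l m)
    (hl : l ^ Fintype.card F ≠ l) : algebraMap F K (A 1 0) ≠ 0 := by
  intro hc
  have ha := h.add_eq
  have hm := h.mul_eq
  simp only [map_add, map_sub, map_mul, hc] at ha hm
  have : (l - algebraMap F K (A 0 0)) * (l - algebraMap F K (A 1 1)) = 0 := by
    linear_combination l * ha - hm
  rcases mul_eq_zero.1 this with h1 | h1 <;> rw [sub_eq_zero] at h1 <;> apply hl <;>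
    rw [h1, ← map_pow, FiniteField.pow_card]

variable [DecidableEq K]

lemma ncard_fixed_of_split {A : GL (Fin 2) F} {l m : F}
    (h : IsEigenPair A (algebraMap F K l) (algebraMap F K m)) (hlm : l ≠ m) (w : ℕ) :
    {x : OnePoint K | projAct K A x = x ∧ (projFrob F K)^[w] x = x}.ncard = 2 := by
  by_cases hc : algebraMap F K (A 1 0) = 0
  · have hc' : A 1 0 = 0 := (_root_.map_eq_zero _).1 hc
    have had : A 1 1 - A 0 0 ≠ 0 := by
      intro h0
      have ha := h.add_eq
      have hm := h.mul_eq
      rw [← map_add] at ha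
      rw [← map_mul] at hm
      have ha := (algebraMap F K).injective ha
      have hm := (algebraMap F K).injective hm
      rw [hc'] at hm
      apply hlm
      have : (l - m) ^ 2 = 0 := by
        linear_combination (l + m + A 0 0 + A 1 1) * ha - 4 * hm + (A 1 1 - A 0 0) * h0
      exact sub_eq_zero.1 (pow_eq_zero_iff two_ne_zero |>.1 this)
    have hset : {x : OnePoint K | projAct K A x = x ∧ (projFrob F K)^[w] x = x} =
        {OnePoint.infty, ((algebraMap F K (A 0 1 / (A 1 1 - A 0 0)) : K) : OnePoint K)} := by
      ext x
      induction x using OnePoint.rec with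
      | infty => simp [projAct_infty_eq_self_iff, hc', iterate_projFrob_infty]
      | coe x =>
        have key : projAct K A x = x ↔ x = algebraMap F K (A 0 1 / (A 1 1 - A 0 0)) := by
          rw [projAct_coe_eq_self_iff, hc, map_div₀, map_sub, eq_div_iff (by
            rw [← map_sub]; exact (_root_.map_ne_zero _).2 had), sub_eq_zero]
          constructor <;> intro h <;> linear_combination h
        simp only [Set.mem_ofPred_eq, key, Set.mem_insert_iff, OnePoint.coe_ne_infty, false_or,
          Set.mem_singleton_iff, OnePoint.coe_eq_coe, and_iff_left_iff_imp]
        rintro rfl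
        exact iterate_projFrob_algebraMap _ _
    rw [hset, Set.ncard_pair (by simp)]
  · have hset : {x : OnePoint K | projAct K A x = x ∧ (projFrob F K)^[w] x = x} =
        {x | projAct K A x = x} := by
      ext x
      simp only [Set.mem_ofPred_eq, and_iff_left_iff_imp]
      intro hx
      have hx : x ∈ {x : OnePoint K | projAct K A x = x} := hx
      rw [h.fixed_eq_of_ne_zero hc, ← map_sub, ← map_div₀, ← map_sub, ← map_div₀] at hx
      rcases hx with rfl | rfl <;> exact iterate_projFrob_algebraMap _ _
    rw [hset, h.fixed_eq_of_ne_zero hc, Set.ncard_pair]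
    rw [Ne, OnePoint.coe_eq_coe, div_left_inj' hc, sub_left_inj]
    exact fun h => hlm ((algebraMap F K).injective h)

lemma ncard_fixed_of_parabolic {A : GL (Fin 2) F} (hA : NonScalar A) {l : F}
    (h : IsEigenPair A (algebraMap F K l) (algebraMap F K l)) (w : ℕ) :
    {x : OnePoint K | projAct K A x = x ∧ (projFrob F K)^[w] x = x}.ncard = 1 := by
  by_cases hc : algebraMap F K (A 1 0) = 0
  · have hc' : A 1 0 = 0 := (_root_.map_eq_zero _).1 hc
    have had : A 0 0 - A 1 1 = 0 := by
      have ha := h.add_eq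
      have hm := h.mul_eq
      rw [← map_add] at ha
      rw [← map_mul] at hm
      have ha := (algebraMap F K).injective ha
      have hm := (algebraMap F K).injective hm
      rw [hc'] at hm
      have : (A 0 0 - A 1 1) ^ 2 = 0 := by
        linear_combination -(l + l + A 0 0 + A 1 1) * ha + 4 * hm
      exact pow_eq_zero_iff two_ne_zero |>.1 this
    have hb : A 0 1 ≠ 0 := fun hb => hA ⟨hb, hc', sub_eq_zero.1 had⟩
    have hset : {x : OnePoint K | projAct K A x = x ∧ (projFrob F K)^[w] x = x} =
        {OnePoint.infty} := by
      ext x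
      induction x using OnePoint.rec with
      | infty => simp [projAct_infty_eq_self_iff, hc', iterate_projFrob_infty]
      | coe x =>
        simp [projAct_coe_eq_self_iff, hc', sub_eq_zero.1 had, hb]
    rw [hset, Set.ncard_singleton]
  · have hset : {x : OnePoint K | projAct K A x = x ∧ (projFrob F K)^[w] x = x} =
        {x | projAct K A x = x} := by
      ext x
      simp only [Set.mem_ofPred_eq, and_iff_left_iff_imp]
      intro hx
      have hx : x ∈ {x : OnePoint K | projAct K A x = x} := hx
      rw [h.fixed_eq_of_ne_zero hc, ← map_sub, ← map_div₀] at hx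
      rcases hx with rfl | rfl <;> exact iterate_projFrob_algebraMap _ _
    rw [hset, h.fixed_eq_of_ne_zero hc, Set.pair_eq_singleton, Set.ncard_singleton]

/-- Frobenius swaps the two eigenvalues, hence the two fixed points. Both are fixed by `σ^w` for
even `w`, neither for odd `w`. -/
lemma ncard_fixed_of_nonsplit {A : GL (Fin 2) F} {l : K}
    (h : IsEigenPair A l (l ^ Fintype.card F)) (hl : l ^ Fintype.card F ≠ l)
    (hl2 : l ^ Fintype.card F ^ 2 = l) (w : ℕ) :
    ({x : OnePoint K | projAct K A x = x ∧ (projFrob F K)^[w] x = x}.ncard : ℤ) =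
      1 + (-1) ^ w := by
  have hc := h.lowerLeft_ne_zero hl
  set q := Fintype.card F with hq
  have hper : ∀ z : K, z ^ q ^ 2 = z → z ^ q ≠ z → (z ^ q ^ w = z ↔ Even w) := by
    intro z hz2 hz
    have hp2 : IsPeriodicPt (FiniteField.frobeniusAlgHom F K) 2 z := by
      rw [IsPeriodicPt, IsFixedPt, iterate_frobenius_apply, hz2]
    have : minimalPeriod (FiniteField.frobeniusAlgHom F K) z = 2 := by
      refine (Nat.dvd_prime Nat.prime_two).1 hp2.minimalPeriod_dvd |>.resolve_left fun h1 => hz ?_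
      exact minimalPeriod_eq_one_iff_isFixedPt.1 h1
    rw [even_iff_two_dvd, ← this, ← isPeriodicPt_iff_minimalPeriod_dvd, IsPeriodicPt, IsFixedPt,
      iterate_frobenius_apply]
  have hfix : ∀ z : K, ((z - algebraMap F K (A 1 1)) / algebraMap F K (A 1 0)) ^ q ^ w =
      (z - algebraMap F K (A 1 1)) / algebraMap F K (A 1 0) ↔ z ^ q ^ w = z := by
    intro z
    rw [div_pow, sub_pow_card_pow, algebraMap_pow_card_pow, algebraMap_pow_card_pow,
      div_left_inj' hc, sub_left_inj]
  have hl' : (l ^ q) ^ q ≠ l ^ q := by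
    rw [← pow_mul, ← pow_two, hl2]
    exact hl.symm
  have hl2' : (l ^ q) ^ q ^ 2 = l ^ q := by
    rw [← pow_mul, mul_comm, pow_mul, hl2]
  have hboth : ∀ x, projAct K A x = x → ((projFrob F K)^[w] x = x ↔ Even w) := by
    intro x hx
    have hx : x ∈ {x : OnePoint K | projAct K A x = x} := hx
    rw [h.fixed_eq_of_ne_zero hc] at hx
    rcases hx with rfl | rfl <;> rw [iterate_projFrob_coe, OnePoint.coe_eq_coe, hfix]
    · exact hper l hl2 hl
    · exact hper _ hl2' hl'
  rcases Nat.even_or_odd w with hw | hw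
  · have hset : {x : OnePoint K | projAct K A x = x ∧ (projFrob F K)^[w] x = x} =
        {x | projAct K A x = x} := by
      ext x
      simp only [Set.mem_ofPred_eq, and_iff_left_iff_imp]
      exact fun hx => (hboth x hx).2 hw
    rw [hset, h.fixed_eq_of_ne_zero hc, Set.ncard_pair, hw.neg_one_pow]
    · norm_num
    · rw [Ne, OnePoint.coe_eq_coe, div_left_inj' hc, sub_left_inj]
      exact hl.symm
  · have hset : {x : OnePoint K | projAct K A x = x ∧ (projFrob F K)^[w] x = x} = ∅ := by
      ext x
      simp only [Set.mem_ofPred_eq, Set.mem_empty_iff_false, iff_false, not_and]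
      exact fun hx h => (Nat.not_even_iff_odd.2 hw) ((hboth x hx).1 h)
    rw [hset, Set.ncard_empty, hw.neg_one_pow]
    norm_num

end FixedPointCounts

/-! ### Counting irreducible polynomials -/

section PolynomialCounts

variable (F : Type*) [Field F] [Fintype F]

/-- The number of monic irreducible polynomials of degree `r` over a finite field. -/
lemma mul_card_monicIrred_eq {r : ℕ} (hr : 0 < r) :
    (r : ℤ) * Nat.card (MonicIrred F r) =
      ∑ d ∈ r.divisors, moebius d * Fintype.card F ^ (r / d) := by
  set K := AlgebraicClosure F
  have hset : ∀ w, 0 < w → ({y : K | y ∈ (Set.univ : Set K) ∧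
      id y = (FiniteField.frobeniusAlgHom F K)^[w] y}.Finite) ∧
      {y : K | y ∈ (Set.univ : Set K) ∧ id y = (FiniteField.frobeniusAlgHom F K)^[w] y}.ncard =
        Fintype.card F ^ w := by
    intro w hw
    set P : K[X] := X ^ Fintype.card F ^ w - X with hP
    have hw2 : 1 < Fintype.card F ^ w := Nat.one_lt_pow hw.ne' Fintype.one_lt_card
    have hP0 : P ≠ 0 := FiniteField.X_pow_card_sub_X_ne_zero K hw2
    have heq : {y : K | y ∈ (Set.univ : Set K) ∧
        id y = (FiniteField.frobeniusAlgHom F K)^[w] y} = P.rootSet K := by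
      ext y
      simp only [Set.mem_univ, true_and, Set.mem_ofPred_eq, iterate_frobenius_apply, id]
      rw [mem_rootSet_of_ne hP0, hP]
      simp [sub_eq_zero, eq_comm]
    have hQ0 : ((Fintype.card F ^ w : ℕ) : K) = 0 := by
      have h1 := congrArg (algebraMap F K) (FiniteField.cast_card_eq_zero F)
      rw [map_natCast, _root_.map_zero] at h1
      rw [Nat.cast_pow, h1, zero_pow hw.ne']
    have hsep : P.Separable := by
      refine ⟨0, -1, ?_⟩
      rw [hP, derivative_sub, derivative_X_pow, hQ0]
      simp
    rw [heq]
    refine ⟨rootSet_finite P K, ?_⟩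
    rw [← Nat.card_coe_set_eq, Nat.card_eq_fintype_card,
      card_rootSet_eq_natDegree hsep (IsAlgClosed.splits _),
      FiniteField.X_pow_card_sub_X_natDegree_eq K hw2]
  -- The sieve for the identity map on the affine line: `D = 1`, and `σ^w` has `q^w` fixed points.
  have h := ncard_minimalPeriod_eq_and_exists (A := (id : K → K))
    (σ := FiniteField.frobeniusAlgHom F K) (Y := Set.univ) (D := 1)
    (T := fun w => (Fintype.card F : ℤ) ^ w) (fun _ => rfl) one_pos (by simp)
    (fun e w hw _ => by rw [iterate_id]; exact (hset w hw).1)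
    (fun e w hw _ => by rw [iterate_id, (hset w hw).2]; push_cast; rfl) hr
  simp only [isUnit_one, IsUnit.dvd, if_true, Nat.totient_one, Nat.cast_one, one_mul, Nat.div_one,
    Nat.gcd_one_right, Finset.filter_true] at h
  rw [← h, ← Nat.cast_mul, mul_card_monicIrred F K]
  congr 2
  ext x
  simp only [Set.mem_univ, true_and, Set.mem_ofPred_eq]
  exact ⟨fun h => ⟨h, 0, hr, rfl⟩, fun h => h.1⟩

end PolynomialCounts

/-! ### Eigenvalue pairs -/

section EigenPairs

variable {F : Type*} [Field F] {K : Type*} [Field K] [Algebra F K]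

lemma isEigenPair_iff (A : GL (Fin 2) F) {t s : F} {l m : K} (ht : algebraMap F K t = l + m)
    (hs : algebraMap F K s = l * m) :
    IsEigenPair A l m ↔ A 0 0 + A 1 1 = t ∧ A 0 0 * A 1 1 - A 0 1 * A 1 0 = s := by
  constructor
  · intro h
    exact ⟨(algebraMap F K).injective (by rw [ht, h.add_eq]),
      (algebraMap F K).injective (by rw [hs, h.mul_eq])⟩
  · rintro ⟨rfl, rfl⟩
    exact ⟨ht.symm, hs.symm⟩

lemma IsEigenPair.eq_or_eq {A : GL (Fin 2) F} {l m l' m' : K} (h : IsEigenPair A l m)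
    (h' : IsEigenPair A l' m') : (l' = l ∧ m' = m) ∨ (l' = m ∧ m' = l) := by
  have h1 := h'.add_eq.trans h.add_eq.symm
  have h2 := h'.mul_eq.trans h.mul_eq.symm
  have h3 : (l' - l) * (l' - m) = 0 := by linear_combination l' * h1 - h2
  rcases mul_eq_zero.1 h3 with h4 | h4 <;> rw [sub_eq_zero] at h4
  · subst h4
    exact Or.inl ⟨rfl, add_left_cancel h1⟩
  · subst h4
    exact Or.inr ⟨rfl, by linear_combination h1⟩

lemma exists_isEigenPair [IsAlgClosed K] (A : GL (Fin 2) F) : ∃ l m : K, IsEigenPair A l m := by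
  obtain ⟨l, hl⟩ := IsAlgClosed.exists_root (C 1 * X ^ 2 +
    C (-algebraMap F K (A 0 0 + A 1 1)) * X +
    C (algebraMap F K (A 0 0 * A 1 1 - A 0 1 * A 1 0)) : K[X])
    (by rw [degree_quadratic one_ne_zero]; norm_num)
  simp only [IsRoot.def, eval_add, eval_mul, eval_C, eval_pow, eval_X] at hl
  refine ⟨l, algebraMap F K (A 0 0 + A 1 1) - l, by ring, by linear_combination -hl⟩

end EigenPairs

/-! ### Counting matrices by eigenvalues, and roots of unity by order -/

section MatrixCounts

variable {F : Type*} [Field F] [Fintype F]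

lemma card_mul_eq [DecidableEq F] (k : F) :
    Nat.card {p : F × F // p.1 * p.2 = k} =
      (Fintype.card F - 1) + if k = 0 then Fintype.card F else 0 := by
  have e : {p : F × F // p.1 * p.2 = k} ≃ Σ b : F, {c : F // b * c = k} :=
    { toFun := fun p => ⟨p.1.1, p.1.2, p.2⟩
      invFun := fun p => ⟨(p.1, p.2.1), p.2.2⟩
      left_inv := fun _ => rfl
      right_inv := fun _ => rfl }
  rw [Nat.card_congr e, Nat.card_sigma, ← Finset.sum_erase_add _ _ (Finset.mem_univ 0)]
  congr 1
  · rw [Finset.sum_congr rfl (g := fun _ => 1), Finset.sum_const, smul_eq_mul, mul_one,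
      Finset.card_erase_of_mem (Finset.mem_univ _), Finset.card_univ]
    intro b hb
    have hb : b ≠ 0 := Finset.ne_of_mem_erase hb
    rw [Nat.card_eq_fintype_card, Fintype.card_eq_one_iff]
    refine ⟨⟨k / b, mul_div_cancel₀ _ hb⟩, fun c => Subtype.ext ?_⟩
    rw [eq_div_iff hb, mul_comm, c.2]
  · split_ifs with h
    · rw [← Nat.card_eq_fintype_card]
      exact Nat.card_congr (Equiv.subtypeUnivEquiv fun c => by rw [zero_mul, h])
    · rw [Nat.card_eq_fintype_card, Fintype.card_eq_zero_iff]
      exact ⟨fun c => h (by rw [← c.2, zero_mul])⟩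

/-- Invertible `2 × 2` matrices with given trace and determinant, by their entries. -/
def traceDetEquiv {t s : F} (hs : s ≠ 0) :
    {A : GL (Fin 2) F // A 0 0 + A 1 1 = t ∧ A 0 0 * A 1 1 - A 0 1 * A 1 0 = s} ≃
      Σ a : F, {p : F × F // p.1 * p.2 = a * (t - a) - s} where
  toFun A := ⟨A.1 0 0, (A.1 0 1, A.1 1 0), by
    simp only
    linear_combination -A.2.2 + A.1 0 0 * A.2.1⟩
  invFun p := ⟨Matrix.GeneralLinearGroup.mkOfDetNeZero !![p.1, p.2.1.1; p.2.1.2, t - p.1] (by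
      rw [Matrix.det_fin_two_of, p.2.2]
      simpa using hs), by
    simp [Matrix.GeneralLinearGroup.mkOfDetNeZero, p.2.2]⟩
  left_inv A := by
    apply Subtype.ext
    ext i j
    have := A.2.1
    fin_cases i <;> fin_cases j <;> simp [Matrix.GeneralLinearGroup.mkOfDetNeZero]
    linear_combination -this
  right_inv p := by
    obtain ⟨a, ⟨b, c⟩, h⟩ := p
    rfl

/-- Fix the upper left entry `a`. The off-diagonal entries have product `a(t - a) - s`, which leaves
`q - 1` choices, and `q` more when that product is zero. -/
lemma ncard_trace_det {t s : F} (hs : s ≠ 0) :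
    {A : GL (Fin 2) F | A 0 0 + A 1 1 = t ∧ A 0 0 * A 1 1 - A 0 1 * A 1 0 = s}.ncard =
      Fintype.card F * (Fintype.card F - 1) +
        {a : F | a * (t - a) - s = 0}.ncard * Fintype.card F := by
  classical
  rw [← Nat.card_coe_set_eq, Set.coe_ofPred, Nat.card_congr (traceDetEquiv hs),
    Nat.card_sigma]
  simp only [card_mul_eq]
  rw [Finset.sum_add_distrib, Finset.sum_const, Finset.card_univ, smul_eq_mul,
    ← Finset.sum_filter, Finset.sum_const, smul_eq_mul, ← Set.ncard_coe_finset]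
  congr 3
  ext a
  simp

variable {K : Type*} [Field K] [Algebra F K]

lemma ncard_isEigenPair {t s : F} {l m : K} (ht : algebraMap F K t = l + m)
    (hs : algebraMap F K s = l * m) (hl : l ≠ 0) (hm : m ≠ 0) :
    {A : GL (Fin 2) F | IsEigenPair A l m}.ncard = Fintype.card F * (Fintype.card F - 1) +
        {a : F | algebraMap F K a = l ∨ algebraMap F K a = m}.ncard * Fintype.card F := by
  have hs0 : s ≠ 0 := by
    rintro rfl
    rw [_root_.map_zero] at hs
    exact mul_ne_zero hl hm hs.symm
  simp only [isEigenPair_iff _ ht hs]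
  rw [ncard_trace_det hs0]
  congr 3
  ext a
  have h1 : algebraMap F K (a * (t - a) - s) =
      -((algebraMap F K a - l) * (algebraMap F K a - m)) := by
    rw [map_sub, map_mul, map_sub, ht, hs]; ring
  rw [Set.mem_ofPred_eq, Set.mem_ofPred_eq, ← _root_.map_eq_zero (algebraMap F K), h1,
    neg_eq_zero, mul_eq_zero, sub_eq_zero, sub_eq_zero]

lemma exists_algebraMap_eq [Algebra.IsAlgebraic F K] {z : K} (hz : z ^ Fintype.card F = z) :
    ∃ a : F, algebraMap F K a = z := by
  have h1 : minimalPeriod (FiniteField.frobeniusAlgHom F K) z = 1 :=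
    minimalPeriod_eq_one_iff_isFixedPt.2 hz
  rw [minimalPeriod_frobenius] at h1
  exact RingHom.mem_range.1
    (minpoly.natDegree_eq_one_iff.1 h1)

lemma IsEigenPair.pow_card {A : GL (Fin 2) F} {l m : K} (h : IsEigenPair A l m) :
    IsEigenPair A (l ^ Fintype.card F) (m ^ Fintype.card F) := by
  have e : ∀ z : K, z ^ Fintype.card F = FiniteField.frobeniusAlgHom F K z := fun z => rfl
  refine ⟨?_, ?_⟩
  · rw [e, e, ← map_add, h.add_eq, AlgHom.commutes]
  · rw [e, e, ← map_mul, h.mul_eq, AlgHom.commutes]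

open Classical in
/-- Double counting: if every `x` related to some index is related to exactly `c` of them. -/
lemma mul_sum_filter_exists {α ι : Type*} [Fintype α] (I : Finset ι) (R : α → ι → Prop) (c : ℕ)
    (hc : ∀ x, (∃ i ∈ I, R x i) → {i ∈ I | R x i}.card = c) (g : α → ℤ) :
    (c : ℤ) * ∑ x with ∃ i ∈ I, R x i, g x = ∑ i ∈ I, ∑ x with R x i, g x := by
  simp only [Finset.sum_filter]
  rw [Finset.sum_comm, Finset.mul_sum]
  refine Finset.sum_congr rfl fun x _ => ?_
  rw [← Finset.sum_filter, Finset.sum_const, nsmul_eq_mul]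
  split_ifs with h
  · rw [hc x h]
  · rw [mul_zero, Finset.filter_eq_empty_iff.2, Finset.card_empty, Nat.cast_zero, zero_mul]
    exact fun i hi hR => h ⟨i, hi, hR⟩

/-- Grouping by order, with `φ(D)` primitive `D`-th roots of unity for each `D ∣ N`. This is the
source of the second totient. -/
lemma sum_nthRootsFinset_orderOf [DecidableEq K] [IsAlgClosed K] {N : ℕ} (hN : (N : K) ≠ 0)
    (H : ℕ → ℤ) :
    ∑ ζ ∈ nthRootsFinset N (1 : K) with ζ ≠ 1, H (orderOf ζ) =
      ∑ D ∈ N.divisors with D ≠ 1, Nat.totient D * H D := by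
  have hN0 : N ≠ 0 := by rintro rfl; exact hN Nat.cast_zero
  rw [← Finset.sum_fiberwise_of_maps_to (g := orderOf) (t := {D ∈ N.divisors | D ≠ 1})]
  · refine Finset.sum_congr rfl fun D hD => ?_
    simp only [Finset.mem_filter, Nat.mem_divisors] at hD
    have hDK : NeZero (D : K) := ⟨fun h => by
      obtain ⟨⟨⟨e, rfl⟩, _⟩, _⟩ := hD
      exact hN (by rw [Nat.cast_mul, h, zero_mul])⟩
    have hD0 : 0 < D := Nat.pos_of_dvd_of_pos hD.1.1 (Nat.pos_of_ne_zero hN0)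
    rw [Finset.sum_congr rfl (g := fun _ => H D) (fun ζ hζ => by
      rw [(Finset.mem_filter.1 hζ).2]), Finset.sum_const, nsmul_eq_mul]
    congr 2
    obtain ⟨z, hz⟩ := HasEnoughRootsOfUnity.exists_primitiveRoot K D
    rw [← hz.card_primitiveRoots]
    congr 1
    ext ζ
    rw [mem_primitiveRoots hD0, Finset.mem_filter, Finset.mem_filter,
      mem_nthRootsFinset (Nat.pos_of_ne_zero hN0)]
    constructor
    · rintro ⟨_, rfl⟩
      exact IsPrimitiveRoot.orderOf ζ
    · intro h
      refine ⟨⟨?_, ?_⟩, h.eq_orderOf.symm⟩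
      · exact (h.pow_eq_one_iff_dvd N).2 hD.1.1
      · rintro rfl
        exact hD.2 (by rw [h.eq_orderOf, orderOf_one])
  · intro ζ hζ
    simp only [Finset.mem_filter, mem_nthRootsFinset (Nat.pos_of_ne_zero hN0)] at hζ
    simp only [Finset.mem_filter, Nat.mem_divisors]
    exact ⟨⟨orderOf_dvd_of_pow_eq_one hζ.1, hN0⟩, fun h => hζ.2 (orderOf_eq_one_iff.1 h)⟩

lemma card_nthRootsFinset_of_ne_zero [IsAlgClosed K] {n : ℕ} (hn : (n : K) ≠ 0) {a : K}
    (ha : a ≠ 0) : (nthRootsFinset n a).card = n := by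
  classical
  have hsep := separable_X_pow_sub_C a hn ha
  rw [nthRootsFinset_def, Multiset.toFinset_card_of_nodup, nthRoots,
    splits_iff_card_roots.1 (IsAlgClosed.splits _), natDegree_X_pow_sub_C]
  exact nodup_roots hsep

end MatrixCounts

/-! ### The cardinality of `F` as an element of `K` -/

section Cardinalities

variable (F : Type*) [Field F] [Fintype F]

lemma pow_card_eq_mul {K : Type*} [Field K] (z : K) :
    z ^ Fintype.card F = z ^ (Fintype.card F - 1) * z := by
  rw [← pow_succ, Nat.sub_add_cancel Fintype.card_pos]

variable (K : Type*) [Field K] [Algebra F K]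

lemma card_sub_one_pos : 0 < Fintype.card F - 1 := by
  have := Fintype.one_lt_card (α := F)
  omega

lemma cast_card_eq_zero : (Fintype.card F : K) = 0 := by
  rw [← map_natCast (algebraMap F K), FiniteField.cast_card_eq_zero, _root_.map_zero]

lemma cast_card_sub_one_ne_zero : ((Fintype.card F - 1 : ℕ) : K) ≠ 0 := by
  rw [Nat.cast_sub Fintype.card_pos, cast_card_eq_zero]
  simp

lemma cast_card_add_one_ne_zero : ((Fintype.card F + 1 : ℕ) : K) ≠ 0 := by
  rw [Nat.cast_add, cast_card_eq_zero]
  simp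

end Cardinalities

/-! ### Matrices with distinct eigenvalues -/

section TorusSums

variable {F : Type*} [Field F] {K : Type*} [Field K] [DecidableEq K]

/-- Pairs `(ζ, z)` with `ζ` a nontrivial `N`-th root of unity and `z ∈ V ζ`; they index the
eigenvalue pairs `(ζ z, z)`. -/
def torusIndex (N : ℕ) (V : K → Finset K) : Finset (Σ _ : K, K) :=
  {ζ ∈ nthRootsFinset N (1 : K) | ζ ≠ 1}.sigma V

lemma mem_torusIndex {N : ℕ} (hN : 0 < N) {V : K → Finset K} {p : Σ _ : K, K} :
    p ∈ torusIndex N V ↔ (p.1 ^ N = 1 ∧ p.1 ≠ 1) ∧ p.2 ∈ V p.1 := by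
  rw [torusIndex, Finset.mem_sigma, Finset.mem_filter, mem_nthRootsFinset hN]

variable (F) in
/-- The second entries of eigenvalue pairs of split semisimple matrices. -/
def splitFiber [Fintype F] (_ : K) : Finset K := nthRootsFinset (Fintype.card F - 1) 1

variable (F) in
/-- The second entries of eigenvalue pairs of nonsplit semisimple matrices. -/
def nonsplitFiber [Fintype F] (ζ : K) : Finset K := nthRootsFinset (Fintype.card F - 1) ζ

lemma mem_splitIndex [Fintype F] {p : Σ _ : K, K}
    (hp : p ∈ torusIndex (Fintype.card F - 1) (splitFiber F)) :
    p.1 ≠ 1 ∧ p.2 ≠ 0 ∧ (p.1 * p.2) ^ Fintype.card F = p.1 * p.2 ∧ p.2 ^ Fintype.card F = p.2 := by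
  have hq := card_sub_one_pos F
  rw [mem_torusIndex hq, splitFiber, mem_nthRootsFinset hq] at hp
  obtain ⟨⟨h1, h2⟩, h3⟩ := hp
  refine ⟨h2, ?_, ?_, ?_⟩
  · intro h0
    rw [h0, zero_pow hq.ne'] at h3
    exact zero_ne_one h3
  · rw [pow_card_eq_mul, mul_pow, h1, h3, one_mul, one_mul]
  · rw [pow_card_eq_mul, h3, one_mul]

/-- The equation `z^(q-1) = ζ` says that the conjugate of `z` is `ζ z`, and `ζ^(q+1) = 1` that
conjugating `ζ z` returns `z`. -/
lemma mem_nonsplitIndex [Fintype F] {p : Σ _ : K, K}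
    (hp : p ∈ torusIndex (Fintype.card F + 1) (nonsplitFiber F)) :
    p.1 ≠ 1 ∧ p.2 ≠ 0 ∧ (p.1 * p.2) ^ Fintype.card F = p.2 ∧
      p.2 ^ Fintype.card F = p.1 * p.2 := by
  have hq := card_sub_one_pos F
  rw [mem_torusIndex (Nat.succ_pos _), nonsplitFiber, mem_nthRootsFinset hq] at hp
  obtain ⟨⟨h1, h2⟩, h3⟩ := hp
  have h4 : p.2 ^ Fintype.card F = p.1 * p.2 := by rw [pow_card_eq_mul, h3]
  refine ⟨h2, ?_, ?_, h4⟩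
  · intro h0
    rw [h0, zero_pow hq.ne'] at h3
    rw [← h3, zero_pow (Nat.succ_ne_zero _)] at h1
    exact zero_ne_one h1
  · rw [mul_pow, h4, ← mul_assoc, ← pow_succ, h1, one_mul]

variable [Algebra F K]

/-- `A` has an eigenvalue pair indexed by `torusIndex N V`. -/
def HasTorusType (N : ℕ) (V : K → Finset K) (A : GL (Fin 2) F) : Prop :=
  ∃ p ∈ torusIndex N V, IsEigenPair A (p.1 * p.2) p.2

-- The factor 2 arises because `(ζ, z)` and `(ζ⁻¹, ζ z)` index the same eigenvalues in the two
-- orders. The hypothesis `hV` makes the index set stable under this swap, so both cases are handled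
-- at once.
open Classical in
lemma two_mul_sum_hasTorusType [IsAlgClosed K] [Fintype (GL (Fin 2) F)] {N : ℕ}
    (hN : (N : K) ≠ 0) {V : K → Finset K}
    (hV : ∀ ζ z, ζ ^ N = 1 → ζ ≠ 1 → z ∈ V ζ → z ≠ 0 ∧ ζ * z ∈ V ζ⁻¹) {n : ℕ}
    (hn : ∀ ζ, ζ ^ N = 1 → ζ ≠ 1 → (V ζ).card = n) {M : ℕ}
    (hM : ∀ p ∈ torusIndex N V, {A : GL (Fin 2) F | IsEigenPair A (p.1 * p.2) p.2}.ncard = M)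
    (g : GL (Fin 2) F → ℤ) (H : ℕ → ℤ)
    (hg : ∀ p ∈ torusIndex N V, ∀ A : GL (Fin 2) F, IsEigenPair A (p.1 * p.2) p.2 →
      g A = H (orderOf p.1)) :
    2 * ∑ A with HasTorusType N V A, g A =
      M * n * ∑ D ∈ N.divisors with D ≠ 1, Nat.totient D * H D := by
  have hN0 : 0 < N := Nat.pos_of_ne_zero (by rintro rfl; exact hN Nat.cast_zero)
  have h := mul_sum_filter_exists (torusIndex N V)
    (fun (A : GL (Fin 2) F) p => IsEigenPair A (p.1 * p.2) p.2) 2 ?_ g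
  · rw [Nat.cast_ofNat] at h
    refine Eq.trans (congrArg _ (Finset.sum_congr ?_ fun _ _ => rfl)) (h.trans ?_)
    · ext A
      simp only [Finset.mem_filter]
      rfl
    · have h1 : ∀ p ∈ torusIndex N V,
          ∑ A : GL (Fin 2) F with IsEigenPair A (p.1 * p.2) p.2, g A = M * H (orderOf p.1) := by
        intro p hp
        rw [Finset.sum_congr rfl (g := fun _ => H (orderOf p.1)) (fun A hA =>
          hg p hp A (Finset.mem_filter.1 hA).2), Finset.sum_const, nsmul_eq_mul, ← hM p hp,
          ← Set.ncard_coe_finset]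
        congr 3
        ext A
        simp
      rw [Finset.sum_congr rfl h1, torusIndex, Finset.sum_sigma,
        ← sum_nthRootsFinset_orderOf hN, Finset.mul_sum]
      refine Finset.sum_congr rfl fun ζ hζ => ?_
      rw [Finset.mem_filter, mem_nthRootsFinset hN0] at hζ
      simp only
      rw [Finset.sum_const, hn ζ hζ.1 hζ.2, nsmul_eq_mul]
      ring
  · rintro A ⟨⟨ζ, z⟩, hp, hR⟩
    rw [mem_torusIndex hN0] at hp
    obtain ⟨⟨hζ, hζ1⟩, hz⟩ := hp
    simp only at hζ hζ1 hz hR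
    have hζ0 : ζ ≠ 0 := by
      rintro rfl
      rw [zero_pow hN0.ne'] at hζ
      exact zero_ne_one hζ
    obtain ⟨hz0, hz'⟩ := hV ζ z hζ hζ1 hz
    have hset : {p ∈ torusIndex N V | IsEigenPair A (p.1 * p.2) p.2} =
        {(⟨ζ, z⟩ : Σ _ : K, K), ⟨ζ⁻¹, ζ * z⟩} := by
      ext ⟨ξ, y⟩
      simp only [Finset.mem_filter, mem_torusIndex hN0, Finset.mem_insert,
        Finset.mem_singleton, Sigma.mk.injEq, heq_eq_eq]
      constructor
      · rintro ⟨⟨⟨_, _⟩, hy⟩, h'⟩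
        rcases hR.eq_or_eq h' with ⟨h1, h2⟩ | ⟨h1, h2⟩
        · subst h2
          exact Or.inl ⟨mul_right_cancel₀ hz0 h1, rfl⟩
        · subst h2
          refine Or.inr ⟨?_, rfl⟩
          refine eq_inv_of_mul_eq_one_left ?_
          exact mul_right_cancel₀ hz0 (by rw [one_mul, mul_assoc, h1])
      · rintro (⟨rfl, rfl⟩ | ⟨rfl, rfl⟩)
        · exact ⟨⟨⟨hζ, hζ1⟩, hz⟩, hR⟩
        · refine ⟨⟨⟨by rw [inv_pow, hζ, inv_one], by rwa [Ne, inv_eq_one]⟩, hz'⟩, ?_⟩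
          rw [inv_mul_cancel_left₀ hζ0]
          exact hR.symm
    rw [hset, Finset.card_pair]
    intro heq
    simp only [Sigma.mk.injEq, heq_eq_eq] at heq
    exact hζ1 (mul_right_cancel₀ hz0 (by rw [one_mul]; exact heq.2.symm))

variable [Fintype F] [IsAlgClosed K] [Algebra.IsAlgebraic F K] {r : ℕ}

variable (K) in
open Classical in
lemma two_mul_sum_split [Fintype (GL (Fin 2) F)] (hr : 3 ≤ r) :
    2 * ∑ A : GL (Fin 2) F with HasTorusType (Fintype.card F - 1) (splitFiber (K := K) F) A,
      (r : ℤ) * {f : MonicIrred F r | makeMonic (mobiusSubst r A.1 f.1) = f.1}.ncard =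
    (Fintype.card F * (Fintype.card F + 1) : ℕ) * (Fintype.card F - 1 : ℕ) *
      ∑ D ∈ (Fintype.card F - 1).divisors with D ≠ 1, Nat.totient D *
        if D ∣ r then Nat.totient D * ∑ d ∈ (r / D).divisors with Nat.gcd d D = 1,
          moebius d * ((Fintype.card F : ℤ) ^ (r / (D * d)) + 1 - 2) else 0 := by
  have hq := card_sub_one_pos F
  refine two_mul_sum_hasTorusType (cast_card_sub_one_ne_zero F K) ?_ ?_ ?_ _
    (fun D => if D ∣ r then Nat.totient D * ∑ d ∈ (r / D).divisors with Nat.gcd d D = 1,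
          moebius d * ((Fintype.card F : ℤ) ^ (r / (D * d)) + 1 - 2) else 0) ?_
  · intro ζ z hζ _ hz
    rw [splitFiber, mem_nthRootsFinset hq] at hz ⊢
    refine ⟨?_, by rw [mul_pow, hζ, hz, one_mul]⟩
    rintro rfl
    rw [zero_pow hq.ne'] at hz
    exact zero_ne_one hz
  · intro ζ _ _
    exact card_nthRootsFinset_of_ne_zero (cast_card_sub_one_ne_zero F K) one_ne_zero
  · intro p hp
    obtain ⟨h1, h2, h3, h4⟩ := mem_splitIndex hp
    obtain ⟨l, hl⟩ := exists_algebraMap_eq h3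
    obtain ⟨m, hm⟩ := exists_algebraMap_eq h4
    have hne : p.1 * p.2 ≠ p.2 := fun h => h1 (mul_right_cancel₀ h2 (by rw [h, one_mul]))
    have hl0 : p.1 * p.2 ≠ 0 := by
      intro h0
      apply h2
      have hp1 : p.1 ≠ 0 := by
        intro h
        have := ((mem_torusIndex hq).1 hp).1.1
        rw [h, zero_pow hq.ne'] at this
        exact zero_ne_one this
      exact (mul_eq_zero.1 h0).resolve_left hp1
    rw [ncard_isEigenPair (t := l + m) (s := l * m) (by rw [map_add, hl, hm])
      (by rw [map_mul, hl, hm]) hl0 h2, ← hl, ← hm]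
    have hset : {a : F | algebraMap F K a = algebraMap F K l ∨
        algebraMap F K a = algebraMap F K m} = {l, m} := by
      ext a
      simp
    -- Two eigenvalues in `F`: `q(q - 1) + 2q = q(q + 1)` matrices.
    rw [hset, Set.ncard_pair (by rintro rfl; exact hne (hl.symm.trans hm))]
    obtain ⟨k, hk⟩ : ∃ k, Fintype.card F = k + 1 := ⟨_, (Nat.sub_add_cancel Fintype.card_pos).symm⟩
    rw [hk, Nat.add_sub_cancel]
    ring
  · intro p hp A hA
    obtain ⟨h1, h2, h3, h4⟩ := mem_splitIndex hp
    have hne : p.1 * p.2 ≠ p.2 := fun h => h1 (mul_right_cancel₀ h2 (by rw [h, one_mul]))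
    have hord : orderOf (p.1 * p.2 / p.2) = orderOf p.1 := by rw [mul_div_cancel_right₀ _ h2]
    have hpos : 0 < orderOf p.1 :=
      (isOfFinOrder_iff_pow_eq_one.2 ⟨_, hq, ((mem_torusIndex hq).1 hp).1.1⟩).orderOf_pos
    have hns : NonScalar A := by
      rintro ⟨e1, e2, e3⟩
      have hs : IsEigenPair A (algebraMap F K (A 0 0)) (algebraMap F K (A 0 0)) :=
        ⟨by rw [e3, map_add], by rw [← map_mul, e1, e3]; simp⟩
      rcases hA.eq_or_eq hs with ⟨i, j⟩ | ⟨i, j⟩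
      · exact hne (i.symm.trans j)
      · exact hne (j.symm.trans i)
    refine mul_ncard_fixed_eq (K := K) hr hns hpos (fun x hx k => ?_) (c := fun _ => 2) ?_
    · rw [← hord]
      exact hA.iterate_eq_self_iff_of_ne hne hx k
    · intro w _
      obtain ⟨l, hl⟩ := exists_algebraMap_eq h3
      obtain ⟨m, hm⟩ := exists_algebraMap_eq h4
      rw [← hl, ← hm] at hA
      rw [ncard_fixed_of_split hA (by rintro rfl; exact hne (hl.symm.trans hm))]
      rfl

variable (K) in
open Classical in
lemma two_mul_sum_nonsplit [Fintype (GL (Fin 2) F)] (hr : 3 ≤ r) :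
    2 * ∑ A : GL (Fin 2) F with HasTorusType (Fintype.card F + 1) (nonsplitFiber (K := K) F) A,
      (r : ℤ) * {f : MonicIrred F r | makeMonic (mobiusSubst r A.1 f.1) = f.1}.ncard =
    (Fintype.card F * (Fintype.card F - 1) : ℕ) * (Fintype.card F - 1 : ℕ) *
      ∑ D ∈ (Fintype.card F + 1).divisors with D ≠ 1, Nat.totient D *
        if D ∣ r then Nat.totient D * ∑ d ∈ (r / D).divisors with Nat.gcd d D = 1,
          moebius d * ((Fintype.card F : ℤ) ^ (r / (D * d)) + 1 - (1 + (-1) ^ (r / (D * d))))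
        else 0 := by
  have hq := card_sub_one_pos F
  refine two_mul_sum_hasTorusType (cast_card_add_one_ne_zero F K) ?_ ?_ ?_ _
    (fun D => if D ∣ r then Nat.totient D * ∑ d ∈ (r / D).divisors with Nat.gcd d D = 1,
          moebius d * ((Fintype.card F : ℤ) ^ (r / (D * d)) + 1 - (1 + (-1) ^ (r / (D * d))))
        else 0) ?_
  · intro ζ z hζ hζ1 hz
    have hp : (⟨ζ, z⟩ : Σ _ : K, K) ∈ torusIndex (Fintype.card F + 1) (nonsplitFiber F) :=
      (mem_torusIndex (Nat.succ_pos _)).2 ⟨⟨hζ, hζ1⟩, hz⟩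
    have hz0 := (mem_nonsplitIndex hp).2.1
    refine ⟨hz0, ?_⟩
    rw [nonsplitFiber, mem_nthRootsFinset hq] at hz ⊢
    rw [mul_pow, hz]
    refine eq_inv_of_mul_eq_one_left ?_
    rw [← hζ, ← pow_succ, ← pow_succ, Nat.sub_add_cancel Fintype.card_pos]
  · intro ζ hζ _
    refine card_nthRootsFinset_of_ne_zero (cast_card_sub_one_ne_zero F K) ?_
    rintro rfl
    rw [zero_pow (Nat.succ_ne_zero _)] at hζ
    exact zero_ne_one hζ
  · intro p hp
    obtain ⟨h1, h2, h3, h4⟩ := mem_nonsplitIndex hp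
    have hne : p.1 * p.2 ≠ p.2 := fun h => h1 (mul_right_cancel₀ h2 (by rw [h, one_mul]))
    have e : ∀ z : K, z ^ Fintype.card F = FiniteField.frobeniusAlgHom F K z := fun z => rfl
    -- Frobenius swaps the two eigenvalues, so their sum and product lie in `F`.
    obtain ⟨t, ht⟩ : ∃ t : F, algebraMap F K t = p.1 * p.2 + p.2 := by
      refine exists_algebraMap_eq ?_
      rw [e, map_add, ← e, ← e, h3, h4, add_comm]
    obtain ⟨s, hs⟩ : ∃ s : F, algebraMap F K s = p.1 * p.2 * p.2 := by
      refine exists_algebraMap_eq ?_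
      rw [mul_pow _ p.2, h3, h4, mul_comm]
    have hl0 : p.1 * p.2 ≠ 0 := by rw [← h4]; exact pow_ne_zero _ h2
    rw [ncard_isEigenPair ht hs hl0 h2]
    have hset : {a : F | algebraMap F K a = p.1 * p.2 ∨ algebraMap F K a = p.2} = ∅ := by
      ext a
      simp only [Set.mem_ofPred_eq, Set.mem_empty_iff_false, iff_false]
      have ha : (algebraMap F K a) ^ Fintype.card F = algebraMap F K a := by
        rw [← map_pow, FiniteField.pow_card]
      rintro (h | h) <;> rw [h] at ha
      · exact hne (ha.symm.trans h3)
      · exact hne (h4.symm.trans ha)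
    rw [hset, Set.ncard_empty, zero_mul, add_zero]
  · intro p hp A hA
    obtain ⟨h1, h2, h3, h4⟩ := mem_nonsplitIndex hp
    have hne : p.1 * p.2 ≠ p.2 := fun h => h1 (mul_right_cancel₀ h2 (by rw [h, one_mul]))
    have hord : orderOf (p.1 * p.2 / p.2) = orderOf p.1 := by rw [mul_div_cancel_right₀ _ h2]
    have hpos : 0 < orderOf p.1 := (isOfFinOrder_iff_pow_eq_one.2
      ⟨_, Nat.succ_pos _, ((mem_torusIndex (Nat.succ_pos _)).1 hp).1.1⟩).orderOf_pos
    have hns : NonScalar A := by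
      rintro ⟨e1, e2, e3⟩
      have hs : IsEigenPair A (algebraMap F K (A 0 0)) (algebraMap F K (A 0 0)) :=
        ⟨by rw [e3, map_add], by rw [← map_mul, e1, e3]; simp⟩
      rcases hA.eq_or_eq hs with ⟨i, j⟩ | ⟨i, j⟩
      · exact hne (i.symm.trans j)
      · exact hne (j.symm.trans i)
    refine mul_ncard_fixed_eq (K := K) hr hns hpos (fun x hx k => ?_)
      (c := fun w => 1 + (-1) ^ w) ?_
    · rw [← hord]
      exact hA.iterate_eq_self_iff_of_ne hne hx k
    · intro w _
      have hA' : IsEigenPair A (p.1 * p.2) ((p.1 * p.2) ^ Fintype.card F) := by rwa [h3]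
      exact ncard_fixed_of_nonsplit hA' (by rw [h3]; exact hne.symm)
        (by rw [pow_two, pow_mul, h3, h4]) w

end TorusSums

/-! ### Matrices with a repeated eigenvalue -/

section RepeatedEigenvalue

variable {F : Type*} [Field F] [Fintype F] {r : ℕ}

variable (K : Type*) [Field K] [Algebra F K] [DecidableEq K] [IsAlgClosed K]
  [Algebra.IsAlgebraic F K]

/-- `A` has a repeated eigenvalue. -/
def HasRepeatedEigenvalue [DecidableEq F] (A : GL (Fin 2) F) : Prop :=
  ∃ l ∈ (Finset.univ.erase 0 : Finset F), IsEigenPair A (algebraMap F K l) (algebraMap F K l)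

-- Each nonzero `l` is the double eigenvalue of `q²` matrices. One is scalar and fixes every
-- polynomial. The other `q² - 1` have `D = 2` and a single, rational fixed point, so the sieve runs
-- with `φ(2) = 1` and `T w = q^w`.
open Classical in
lemma sum_hasRepeatedEigenvalue [CharP F 2] [Fintype (GL (Fin 2) F)] (hr : 3 ≤ r) :
    ∑ A : GL (Fin 2) F with HasRepeatedEigenvalue K A,
      (r : ℤ) * {f : MonicIrred F r | makeMonic (mobiusSubst r A.1 f.1) = f.1}.ncard =
    (Fintype.card F - 1 : ℕ) * (r * Nat.card (MonicIrred F r) +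
      ((Fintype.card F : ℤ) ^ 2 - 1) * if 2 ∣ r then
        ∑ d ∈ (r / 2).divisors with Nat.gcd d 2 = 1,
          moebius d * (Fintype.card F : ℤ) ^ (r / (2 * d)) else 0) := by
  have : CharP K 2 := charP_of_injective_algebraMap (algebraMap F K).injective 2
  set S : ℤ := if 2 ∣ r then ∑ d ∈ (r / 2).divisors with Nat.gcd d 2 = 1,
          moebius d * (Fintype.card F : ℤ) ^ (r / (2 * d)) else 0 with hS
  set g : GL (Fin 2) F → ℤ := fun A =>
    (r : ℤ) * {f : MonicIrred F r | makeMonic (mobiusSubst r A.1 f.1) = f.1}.ncard with hg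
  have h := mul_sum_filter_exists (Finset.univ.erase 0 : Finset F)
    (fun (A : GL (Fin 2) F) l => IsEigenPair A (algebraMap F K l) (algebraMap F K l)) 1 ?_ g
  · rw [Nat.cast_one, one_mul] at h
    refine (Finset.sum_congr ?_ fun _ _ => rfl).trans (h.trans ?_)
    · ext A
      simp only [Finset.mem_filter]
      rfl
    · rw [Finset.sum_congr rfl (g := fun _ => r * Nat.card (MonicIrred F r) +
        ((Fintype.card F : ℤ) ^ 2 - 1) * S), Finset.sum_const,
        Finset.card_erase_of_mem (Finset.mem_univ _), Finset.card_univ, nsmul_eq_mul]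
      intro l hl
      have hl : l ≠ 0 := Finset.ne_of_mem_erase hl
      have hl' : algebraMap F K l ≠ 0 := (_root_.map_ne_zero _).2 hl
      have hcard := ncard_isEigenPair (K := K) (t := l + l) (s := l * l) (map_add _ _ _)
        (map_mul _ _ _) hl' hl'
      have hset : {a : F | algebraMap F K a = algebraMap F K l ∨
          algebraMap F K a = algebraMap F K l} = {l} := by
        ext a
        simp
      rw [hset, Set.ncard_singleton, one_mul] at hcard
      have hcoe : ((Finset.univ.filter fun A : GL (Fin 2) F =>
          IsEigenPair A (algebraMap F K l) (algebraMap F K l)).card : ℤ) =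
          (Fintype.card F : ℤ) ^ 2 := by
        rw [← Set.ncard_coe_finset]
        have : ((Finset.univ.filter fun A : GL (Fin 2) F =>
          IsEigenPair A (algebraMap F K l) (algebraMap F K l)) : Set (GL (Fin 2) F)) =
          {A : GL (Fin 2) F | IsEigenPair A (algebraMap F K l) (algebraMap F K l)} := by
          ext A; simp
        rw [this, hcard]
        obtain ⟨k, hk⟩ : ∃ k, Fintype.card F = k + 1 :=
          ⟨_, (Nat.sub_add_cancel Fintype.card_pos).symm⟩
        rw [hk, Nat.add_sub_cancel]
        push_cast
        ring
      rw [← Finset.sum_filter_add_sum_filter_not _ (fun A => ¬ NonScalar A)]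
      simp only [not_not]
      set A₀ : GL (Fin 2) F := Matrix.GeneralLinearGroup.mkOfDetNeZero !![l, 0; 0, l]
        (by simpa [Matrix.det_fin_two_of] using hl) with hA₀
      have hsc : {A ∈ (Finset.univ.filter fun A : GL (Fin 2) F =>
          IsEigenPair A (algebraMap F K l) (algebraMap F K l)) | ¬ NonScalar A} = {A₀} := by
        ext A
        simp only [Finset.mem_filter, Finset.mem_univ, true_and, Finset.mem_singleton]
        constructor
        · rintro ⟨hA, hs⟩
          obtain ⟨h1, h2, h3⟩ := not_not.1 hs
          obtain ⟨ht, hd⟩ := (isEigenPair_iff A (map_add _ l l) (map_mul _ l l)).1 hA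
          have hal : A 0 0 = l := by
            have : (A 0 0 - l) ^ 2 = 0 := by
              rw [h1, ← h3] at hd
              rw [← h3] at ht
              linear_combination A 0 0 * ht - hd
            exact sub_eq_zero.1 (pow_eq_zero_iff two_ne_zero |>.1 this)
          ext i j
          fin_cases i <;> fin_cases j <;>
            simp [hA₀, Matrix.GeneralLinearGroup.mkOfDetNeZero, h1, h2, hal, ← h3]
        · rintro rfl
          refine ⟨(isEigenPair_iff _ (map_add _ l l) (map_mul _ l l)).2 ?_, not_not.2 ?_⟩ <;>
            simp [hA₀, Matrix.GeneralLinearGroup.mkOfDetNeZero]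
      have hsplit := Finset.card_filter_add_card_filter_not
        (s := Finset.univ.filter fun A : GL (Fin 2) F =>
          IsEigenPair A (algebraMap F K l) (algebraMap F K l)) (fun A => ¬ NonScalar A)
      simp only [not_not] at hsplit
      rw [hsc, Finset.card_singleton] at hsplit
      rw [← hsplit] at hcoe
      rw [hsc, Finset.sum_singleton]
      congr 1
      · have hA₀s : ¬ NonScalar A₀ := by
          have : A₀ ∈ ({A₀} : Finset (GL (Fin 2) F)) := Finset.mem_singleton_self _
          rw [← hsc] at this
          exact (Finset.mem_filter.1 this).2
        simp only [hg, makeMonic_mobiusSubst_of_not_nonScalar hA₀s]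
        rw [Set.ofPred_true, Set.ncard_univ]
      · rw [Finset.sum_congr rfl (g := fun _ => S), Finset.sum_const, nsmul_eq_mul]
        · congr 1
          push_cast at hcoe
          linarith
        · intro A hA
          simp only [Finset.mem_filter, Finset.mem_univ, true_and] at hA
          have := mul_ncard_fixed_eq (K := K) hr hA.2 two_pos
            (fun x hx k => hA.1.iterate_eq_self_iff_of_eq hx k) (c := fun _ => 1)
            (fun w _ => by rw [ncard_fixed_of_parabolic hA.2 hA.1]; rfl)
          rw [hg, hS]
          simp only
          rw [this]
          simp
  · rintro A ⟨l, hl, hA⟩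
    rw [Finset.card_eq_one]
    refine ⟨l, ?_⟩
    ext m
    rw [Finset.mem_filter, Finset.mem_singleton]
    constructor
    · rintro ⟨_, hm⟩
      rcases hA.eq_or_eq hm with ⟨h1, _⟩ | ⟨h1, _⟩ <;> exact (algebraMap F K).injective h1
    · rintro rfl
      exact ⟨hl, hA⟩

end RepeatedEigenvalue

/-! ### The three types of matrices -/

section Classification

variable {F : Type*} [Field F] [Fintype F] {K : Type*} [Field K] [Algebra F K]
  {A : GL (Fin 2) F} {l m : K}

/-- Frobenius permutes the eigenvalues, so a double one is fixed by it and lies in `F`. -/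
lemma IsEigenPair.hasRepeatedEigenvalue_iff [DecidableEq F] [Algebra.IsAlgebraic F K]
    (h : IsEigenPair A l m) : HasRepeatedEigenvalue K A ↔ l = m := by
  constructor
  · rintro ⟨a, _, ha⟩
    rcases ha.eq_or_eq h with ⟨h1, h2⟩ | ⟨h1, h2⟩ <;> exact h1.trans h2.symm
  · rintro rfl
    have hl : l ^ Fintype.card F = l := by
      rcases h.eq_or_eq h.pow_card with ⟨h1, _⟩ | ⟨h1, _⟩ <;> exact h1
    obtain ⟨a, rfl⟩ := exists_algebraMap_eq hl
    refine ⟨a, Finset.mem_erase.2 ⟨?_, Finset.mem_univ _⟩, h⟩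
    rintro rfl
    exact h.left_ne_zero (_root_.map_zero _)

variable [DecidableEq K]

lemma IsEigenPair.hasTorusType_split_iff (h : IsEigenPair A l m) :
    HasTorusType (Fintype.card F - 1) (splitFiber (K := K) F) A ↔
      l ≠ m ∧ l ^ Fintype.card F = l := by
  have hq := card_sub_one_pos F
  constructor
  · rintro ⟨p, hp, hA⟩
    obtain ⟨h1, h2, h3, h4⟩ := mem_splitIndex hp
    have hne : p.1 * p.2 ≠ p.2 := fun h => h1 (mul_right_cancel₀ h2 (by rw [h, one_mul]))
    rcases hA.eq_or_eq h with ⟨rfl, rfl⟩ | ⟨rfl, rfl⟩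
    · exact ⟨hne, h3⟩
    · exact ⟨hne.symm, h4⟩
  · rintro ⟨hlm, hl⟩
    have hm : m ^ Fintype.card F = m := by
      rcases h.eq_or_eq h.pow_card with ⟨_, h2⟩ | ⟨h1, _⟩
      · exact h2
      · exact absurd (hl.symm.trans h1) hlm
    have hl0 := h.left_ne_zero
    have hm0 := h.symm.left_ne_zero
    have key : ∀ z : K, z ≠ 0 → z ^ Fintype.card F = z → z ^ (Fintype.card F - 1) = 1 := by
      intro z hz0 hz
      rw [pow_card_eq_mul] at hz
      exact mul_right_cancel₀ hz0 (by rw [hz, one_mul])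
    refine ⟨⟨l / m, m⟩, (mem_torusIndex hq).2 ⟨⟨?_, ?_⟩, ?_⟩, ?_⟩
    · simp only
      rw [div_pow, key l hl0 hl, key m hm0 hm, div_one]
    · rwa [Ne, div_eq_one_iff_eq hm0]
    · rw [splitFiber, mem_nthRootsFinset hq]
      exact key m hm0 hm
    · simp only
      rwa [div_mul_cancel₀ _ hm0]

lemma IsEigenPair.hasTorusType_nonsplit_iff (h : IsEigenPair A l m) :
    HasTorusType (Fintype.card F + 1) (nonsplitFiber (K := K) F) A ↔
      l ≠ m ∧ l ^ Fintype.card F ≠ l := by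
  have hq := card_sub_one_pos F
  constructor
  · rintro ⟨p, hp, hA⟩
    obtain ⟨h1, h2, h3, h4⟩ := mem_nonsplitIndex hp
    have hne : p.1 * p.2 ≠ p.2 := fun h => h1 (mul_right_cancel₀ h2 (by rw [h, one_mul]))
    rcases hA.eq_or_eq h with ⟨rfl, rfl⟩ | ⟨rfl, rfl⟩
    · exact ⟨hne, by rw [h3]; exact hne.symm⟩
    · exact ⟨hne.symm, by rw [h4]; exact hne⟩
  · rintro ⟨hlm, hl⟩
    obtain ⟨hl', hm'⟩ : l ^ Fintype.card F = m ∧ m ^ Fintype.card F = l := by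
      rcases h.eq_or_eq h.pow_card with ⟨h1, _⟩ | h1
      · exact absurd h1 hl
      · exact h1
    have hl0 := h.left_ne_zero
    have hm0 := h.symm.left_ne_zero
    refine ⟨⟨l / m, m⟩, (mem_torusIndex (Nat.succ_pos _)).2 ⟨⟨?_, ?_⟩, ?_⟩, ?_⟩
    · simp only
      rw [div_pow, pow_succ, pow_succ, hl', hm', mul_comm, div_self (mul_ne_zero hl0 hm0)]
    · rwa [Ne, div_eq_one_iff_eq hm0]
    · rw [nonsplitFiber, mem_nthRootsFinset hq, eq_div_iff hm0, ← pow_card_eq_mul, hm']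
    · simp only
      rwa [div_mul_cancel₀ _ hm0]

-- In terms of the eigenvalues the three types read `l = m`, then `l ≠ m` with `l^q = l`, then `l ≠
-- m` with `l^q ≠ l`. Exactly one of them holds.
variable (K) in
open Classical in
lemma sum_eq_sum_types [IsAlgClosed K] [Algebra.IsAlgebraic F K] [DecidableEq F]
    [Fintype (GL (Fin 2) F)] (g : GL (Fin 2) F → ℤ) :
    ∑ A, g A = ∑ A with HasRepeatedEigenvalue K A, g A +
      ∑ A with HasTorusType (Fintype.card F - 1) (splitFiber (K := K) F) A, g A +
      ∑ A with HasTorusType (Fintype.card F + 1) (nonsplitFiber (K := K) F) A, g A := by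
  rw [Finset.sum_filter, Finset.sum_filter, Finset.sum_filter, ← Finset.sum_add_distrib,
    ← Finset.sum_add_distrib]
  refine Finset.sum_congr rfl fun A _ => ?_
  obtain ⟨l, m, h⟩ := exists_isEigenPair (K := K) A
  simp only [h.hasRepeatedEigenvalue_iff, h.hasTorusType_split_iff, h.hasTorusType_nonsplit_iff]
  by_cases hlm : l = m <;> by_cases hl : l ^ Fintype.card F = l <;> simp [hlm, hl]

end Classification

/-! ### Burnside's lemma -/

section Orbits

variable (F : Type*) [Field F]

lemma orbitRel_pgl_iff {r : ℕ} (hr : 2 ≤ r) (f g : MonicIrred F r) :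
    (@MulAction.orbitRel PGL(2, F) _ _ (pglAction F r hr)) f g ↔
      (@MulAction.orbitRel (GL (Fin 2) F) _ _ (glAction F r hr)) f g := by
  let := glAction F r hr
  let := pglAction F r hr
  rw [MulAction.orbitRel_apply, MulAction.orbitRel_apply]
  constructor
  · rintro ⟨x, hx⟩
    induction x using Matrix.ProjGenLinGroup.induction_on with
    | mk A => exact ⟨A, hx⟩
  · rintro ⟨A, hA⟩
    exact ⟨Matrix.ProjGenLinGroup.mk A, hA⟩

variable [Fintype F]

instance finite_PGLOrbits (r : ℕ) (hr : 2 ≤ r) : Finite (PGLOrbits F r hr) :=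
  Quotient.finite _

lemma card_GL_two : (Nat.card (GL (Fin 2) F) : ℤ) =
    ((Fintype.card F : ℤ) ^ 2 - 1) * ((Fintype.card F : ℤ) ^ 2 - Fintype.card F) := by
  have h1 : 1 ≤ Fintype.card F ^ 2 := Nat.one_le_pow _ _ Fintype.card_pos
  have h2 : Fintype.card F ≤ Fintype.card F ^ 2 := Nat.le_self_pow two_ne_zero _
  rw [Matrix.card_GL_field, Fin.prod_univ_two]
  simp only [Fin.val_zero, Fin.val_one, pow_zero, pow_one]
  push_cast [Nat.cast_sub h1, Nat.cast_sub h2]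
  ring

lemma sum_ncard_fixed_eq [Fintype (GL (Fin 2) F)] {r : ℕ} (hr : 2 ≤ r) :
    ∑ A : GL (Fin 2) F, {f : MonicIrred F r | makeMonic (mobiusSubst r A.1 f.1) = f.1}.ncard =
      Nat.card (PGLOrbits F r hr) * Nat.card (GL (Fin 2) F) := by
  classical
  let := glAction F r hr
  have e : PGLOrbits F r hr ≃ MulAction.orbitRel.Quotient (GL (Fin 2) F) (MonicIrred F r) :=
    Quotient.congr (Equiv.refl _) (orbitRel_pgl_iff F hr)
  have : Finite (MulAction.orbitRel.Quotient (GL (Fin 2) F) (MonicIrred F r)) :=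
    Finite.of_equiv _ e
  have : Fintype (MulAction.orbitRel.Quotient (GL (Fin 2) F) (MonicIrred F r)) :=
    Fintype.ofFinite _
  have : Fintype (MonicIrred F r) := Fintype.ofFinite _
  have h := MulAction.sum_card_fixedBy_eq_card_orbits_mul_card_group (GL (Fin 2) F)
    (MonicIrred F r)
  rw [Nat.card_congr e, Nat.card_eq_fintype_card, Nat.card_eq_fintype_card, ← h]
  refine Finset.sum_congr rfl fun A _ => ?_
  rw [← Nat.card_eq_fintype_card, Nat.card_coe_set_eq]
  congr 1
  ext f
  exact (Subtype.ext_iff (a1 := A • f) (a2 := f)).symm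

end Orbits

lemma sum_divisors_gcd {M : Type*} [AddCommMonoid M] {r N : ℕ} (hr : 0 < r) (hN : 0 < N)
    (f : ℕ → M) :
    ∑ D ∈ N.divisors with D ≠ 1, (if D ∣ r then f D else 0) =
      ∑ D ∈ (Nat.gcd r N).divisors with D ≠ 1, f D := by
  rw [← Finset.sum_filter]
  refine Finset.sum_congr ?_ fun _ _ => rfl
  ext D
  simp only [Finset.mem_filter, Nat.mem_divisors, Nat.dvd_gcd_iff]
  have : r.gcd N ≠ 0 := (Nat.gcd_pos_of_pos_left _ hr).ne'
  have := hN.ne'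
  tauto

/-! ### Assembling the formula -/

section Formula

variable (F : Type*) [Field F] [Fintype F]

lemma card_monicIrred_eq_N0 {r : ℕ} (hr : 0 < r) :
    (Nat.card (MonicIrred F r) : ℚ) = N0 (Fintype.card F) r := by
  have h := congrArg (Int.cast : ℤ → ℚ) (mul_card_monicIrred_eq F hr)
  push_cast at h
  have hr' : (r : ℚ) ≠ 0 := by exact_mod_cast hr.ne'
  rw [N0, ← h]
  field_simp

lemma card_PGLOrbits [CharP F 2] {r : ℕ} (hr : 3 ≤ r) (hr2 : 2 ≤ r) :
    (Nat.card (PGLOrbits F r hr2) : ℚ) =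
      1 / ((Fintype.card F : ℚ) * ((Fintype.card F : ℚ) ^ 2 - 1)) *
        (N0 (Fintype.card F) r + N1 (Fintype.card F) r + N2 (Fintype.card F) r +
          N3 (Fintype.card F) r) := by
  classical
  set K := AlgebraicClosure F
  have : Fintype (GL (Fin 2) F) := Fintype.ofFinite _
  have hr0 : 0 < r := by omega
  have hrQ : (r : ℚ) ≠ 0 := by exact_mod_cast hr0.ne'
  have hq1 := card_sub_one_pos F
  have hburnside := congrArg (fun x : ℕ => (r : ℤ) * (x : ℤ)) (sum_ncard_fixed_eq F hr2)
  simp only [Nat.cast_sum, Nat.cast_mul, card_GL_two, Finset.mul_sum] at hburnside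
  have hsum := sum_eq_sum_types K (fun A : GL (Fin 2) F =>
    (r : ℤ) * {f : MonicIrred F r | makeMonic (mobiusSubst r A.1 f.1) = f.1}.ncard)
  have hrep := sum_hasRepeatedEigenvalue K (F := F) hr
  have hspl := two_mul_sum_split K (F := F) hr
  have hnon := two_mul_sum_nonsplit K (F := F) hr
  have hI := card_monicIrred_eq_N0 F hr0
  have e0 : ((r : ℤ) * Nat.card (MonicIrred F r) : ℚ) = r * N0 (Fintype.card F) r := by
    rw [hI]; norm_cast
  set q := Fintype.card F with hq
  have e1 : (r : ℚ) * N1 q r = ((q : ℚ) ^ 2 - 1) * ((if 2 ∣ r then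
        ∑ d ∈ (r / 2).divisors with Nat.gcd d 2 = 1,
          moebius d * (q : ℤ) ^ (r / (2 * d)) else 0 : ℤ) : ℚ) := by
    rw [N1]
    split_ifs
    · simp only [Nat.gcd_comm 2]
      push_cast
      field_simp
    · simp
  have e2 : 2 * (r : ℚ) * N2 q r = q * (q + 1) *
      ((∑ D ∈ (q - 1).divisors with D ≠ 1, Nat.totient D *
        if D ∣ r then Nat.totient D * ∑ d ∈ (r / D).divisors with Nat.gcd d D = 1,
          moebius d * ((q : ℤ) ^ (r / (D * d)) + 1 - 2) else 0 : ℤ) : ℚ) := by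
    simp only [mul_ite, mul_zero]
    rw [sum_divisors_gcd hr0 hq1, N2]
    push_cast
    rw [Finset.mul_sum, Finset.mul_sum, Finset.mul_sum]
    refine Finset.sum_congr rfl fun D _ => ?_
    have : ∀ x : ℚ, x + 1 - 2 = x - 1 := fun x => by ring
    simp only [this]
    field_simp
  have e3 : 2 * (r : ℚ) * N3 q r = q * (q - 1) *
      ((∑ D ∈ (q + 1).divisors with D ≠ 1, Nat.totient D *
        if D ∣ r then Nat.totient D * ∑ d ∈ (r / D).divisors with Nat.gcd d D = 1,
          moebius d * ((q : ℤ) ^ (r / (D * d)) + 1 - (1 + (-1) ^ (r / (D * d)))) else 0 : ℤ) :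
        ℚ) := by
    simp only [mul_ite, mul_zero]
    rw [sum_divisors_gcd hr0 (Nat.succ_pos q), N3]
    push_cast
    rw [Finset.mul_sum, Finset.mul_sum, Finset.mul_sum]
    refine Finset.sum_congr rfl fun D _ => ?_
    have : ∀ (x : ℚ) (k : ℕ), x + 1 - (1 + (-1) ^ k) = x + (-1) ^ (k + 1) := fun x k => by
      rw [pow_succ]; ring
    simp only [this]
    field_simp
  rw [hsum] at hburnside
  have hb := congrArg (fun x : ℤ => 2 * (x : ℚ)) hburnside
  have hrep' := congrArg (Int.cast : ℤ → ℚ) hrep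
  have hspl' := congrArg (Int.cast : ℤ → ℚ) hspl
  have hnon' := congrArg (Int.cast : ℤ → ℚ) hnon
  have hqc : ((q - 1 : ℕ) : ℚ) = q - 1 := by rw [Nat.cast_sub Fintype.card_pos, Nat.cast_one]
  simp only [Int.cast_add, Int.cast_mul, Int.cast_sub, Int.cast_pow, Int.cast_natCast,
    Int.cast_one, Int.cast_ofNat, Nat.cast_mul, Nat.cast_add, Nat.cast_one, hqc]
    at hb hrep' hspl' hnon' e0 e1 e2 e3
  have hq2 : (1 : ℚ) < q := by exact_mod_cast Fintype.one_lt_card (α := F)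
  have hqa : (q : ℚ) - 1 ≠ 0 := by linarith
  have hqb : (q : ℚ) ^ 2 - 1 ≠ 0 := by nlinarith
  have hqd : (q : ℚ) ≠ 0 := by linarith
  rw [eq_comm, one_div, inv_mul_eq_iff_eq_mul₀ (mul_ne_zero hqd hqb)]
  -- The factor 2 comes from ordering the eigenvalues, `r` from counting roots instead of
  -- polynomials, and `q - 1` from the scalars in `GL₂`.
  have hfin : 2 * (r : ℚ) * (q - 1) * (N0 q r + N1 q r + N2 q r + N3 q r) =
      2 * (r : ℚ) * (q - 1) * (q * (q ^ 2 - 1) * Nat.card (PGLOrbits F r hr2)) := by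
    linear_combination hb - 2 * hrep' - hspl' - hnon' - 2 * (q - 1) * e0 + 2 * (q - 1) * e1 +
      (q - 1) * e2 + (q - 1) * e3
  exact mul_left_cancel₀ (mul_ne_zero (mul_ne_zero two_ne_zero hrQ) hqa) hfin

end Formula

end GoppaOrbits

end

theorem theorem3 (n r q : ℕ) (hn : n.Prime) (hn5 : 5 ≤ n) (hr : 3 ≤ r) (hrn : Nat.Coprime r n)
    (hq : q = 2 ^ n) (F : Type*) [Field F] [Fintype F] (hF : Fintype.card F = q) :
    (Nat.card (GoppaOrbits.MonicIrred F r) : ℚ) = GoppaOrbits.N0 q r ∧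
    Finite (GoppaOrbits.PGLOrbits F r (le_trans (by norm_num) hr)) ∧
    (Nat.card (GoppaOrbits.PGLOrbits F r (le_trans (by norm_num) hr)) : ℚ) =
      1 / ((q : ℚ) * ((q : ℚ) ^ 2 - 1)) *
        (GoppaOrbits.N0 q r + GoppaOrbits.N1 q r + GoppaOrbits.N2 q r + GoppaOrbits.N3 q r) := by
  have : Fact (Nat.Prime 2) := ⟨Nat.prime_two⟩
  have : CharP F 2 := charP_of_card_eq_prime_pow (hF.trans hq)
  subst hF
  exact ⟨GoppaOrbits.card_monicIrred_eq_N0 F (by omega), inferInstance,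
    GoppaOrbits.card_PGLOrbits F hr _⟩
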